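/- Let $dA(z)=\frac1\pi\,dx\,dy$ be the normalized area measure on $\mathbb C$ and $d\lambda(z)=\frac12 e^{-|z|^2/2}\,dA(z)$ the Gaussian measure. Let $\mathcal F^2$ be the Fock space of all entire functions in $L^2(\mathbb C,d\lambda)$, a closed subspace with orthogonal projection $P:L^2(\mathbb C,d\lambda)\to\mathcal F^2$, reproducing kernel $K_z(w)=e^{\bar z w/2}$ and normalized reproducing kernel $k_z(w)=e^{\bar z w/2-|z|^2/4}$. Let $\varphi:\mathbb C\to\mathbb R$ be a bounded positive function, that is, $\varphi\in L^\infty(\mathbb C,dA)$ and $\varphi\ge 0$ almost everywhere, and let $d\mu=\varphi\,dA$. Let $T_\varphi f=P(\varphi f)$ be the Toeplitz operator on $\mathcal F^2$ and $\widetilde\varphi(z)=\int_{\mathbb C}\varphi\,|k_z|^2\,d\lambda$ the Berezin transform. Then $T_\varphi=T_\mu$, that is, $$T_\varphi f(z)=\frac12\int_{\mathbb C} f(w)\,\overline{K_z(w)}\,e^{-|w|^2/2}\,d\mu(w)\qquad(f\in\mathcal F^2,\ z\in\mathbb C)$$ with an absolutely convergent integral, and $\widetilde\varphi=\widetilde\mu$,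 that is, $\widetilde\varphi(z)=\frac12\int_{\mathbb C}|k_z(w)|^2e^{-|w|^2/2}\,d\mu(w)$ for all $z\in\mathbb C$. Moreover, the following statements are equivalent: (a) $T_\mu=T_\varphi$ is invertible on $\mathcal F^2$ (it has a bounded two-sided inverse); (b) $\widetilde\mu=\widetilde\varphi$ is bounded below on $\mathbb C$: there is $\delta>0$ with $\widetilde\varphi(z)\ge\delta$ for all $z\in\mathbb C$; (c) there is an $r>0$ such that $\chi_{\{z\in\mathbb C:\varphi(z)>r\}}\,dA$ is a reverse Carleson measure for $\mathcal F^2$ (equivalently, for some $C>0$, $\int_{\{\varphi>r\}}|f|^2\,d\lambda\ge C\int_{\mathbb C}|f|^2\,d\lambda$ for all $f\in\mathcal F^2$); (d) $\mu$ is a reverse Carleson measure for $\mathcal F^2$; (e) $\mu$ satisfies the reverse Carleson condition for $\mathcal F^2$. Here a positive Borel measure $\nu$ on $\mathbb C$ is a reverse Carleson measure for $\mathcal F^2$ if there is a constant $C>0$ such that $\int_{\mathbb C}|f(w)|^2e^{-|w|^2/2}\,d\nu(w)\ge C\int_{\mathbb C}|f(w)|^2e^{-|w|^2/2}\,dA(w)$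 for all $f\in\mathcal F^2$; it satisfies the reverse Carleson condition for $\mathcal F^2$ if there are $r>0$ and $C>0$ such that $C^{-1}\le\nu(B(z,r))\le C$ for all $z\in\mathbb C$, where $B(z,r)=\{w:|w-z|<r\}$. -/

import Mathlib

open MeasureTheory Filter Topology
open scoped ENNReal ComplexConjugate

noncomputable section
namespace Fock

/-- The normalized area measure `dA = dx dy / π` on the complex plane. -/
def areaMeasure : Measure ℂ := ENNReal.ofReal (Real.pi)⁻¹ • volume

/-- The Gaussian measure `dλ(z) = (1/2) exp(-|z|²/2) dA(z)`. -/
def gaussianMeasure : Measure ℂ :=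
  areaMeasure.withDensity fun z => ENNReal.ofReal ((1 / 2) * Real.exp (-‖z‖ ^ 2 / 2))

theorem gaussianMeasure_absolutelyContinuous : gaussianMeasure ≪ areaMeasure :=
  withDensity_absolutelyContinuous _ _

theorem volume_absolutelyContinuous_area : (volume : Measure ℂ) ≪ areaMeasure :=
  Measure.absolutelyContinuous_smul (by simp [Real.pi_pos])

theorem area_absolutelyContinuous_gaussian : areaMeasure ≪ gaussianMeasure := by
  refine withDensity_absolutelyContinuous' ?_ ?_
  · exact Measurable.aemeasurable (by fun_prop)
  · refine Eventually.of_forall fun z => ?_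
    simp [Real.exp_pos]

instance isOpenPosMeasure_gaussian : gaussianMeasure.IsOpenPosMeasure :=
  (volume_absolutelyContinuous_area.trans area_absolutelyContinuous_gaussian).isOpenPosMeasure

theorem enorm_le_circle {G : ℂ → ℂ} (hG : Differentiable ℂ G) (z : ℂ) (r : ℝ) :
    ‖G z‖ₑ ≤ ∫⁻ t in Set.Ioo (-Real.pi) Real.pi, ‖G (circleMap z r t)‖ₑ := by
  have h1 : Real.circleAverage G z r = G z := hG.diffContOnCl.circleAverage
  rw [Real.circleAverage_eq_integral_add (-Real.pi)] at h1
  rw [intervalIntegral.integral_comp_add_right (fun t => G (circleMap z r t))] at h1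
  rw [← h1, enorm_smul, intervalIntegral.integral_of_le (by linarith [Real.pi_pos])]
  have h2 : ‖(2 * Real.pi)⁻¹‖ₑ ≤ 1 := by
    rw [Real.enorm_eq_ofReal (by positivity), ← ENNReal.ofReal_one]
    refine ENNReal.ofReal_le_ofReal (inv_le_one_of_one_le₀ ?_)
    linarith [Real.two_le_pi]
  refine (mul_le_mul' h2 (enorm_integral_le_lintegral_enorm _)).trans (le_of_eq ?_)
  rw [one_mul, show (0 : ℝ) + -Real.pi = -Real.pi by ring,
    show 2 * Real.pi + -Real.pi = Real.pi by ring, restrict_Ioo_eq_restrict_Ioc]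

theorem enorm_le_ball {G : ℂ → ℂ} (hG : Differentiable ℂ G) (z : ℂ) :
    ‖G z‖ₑ ≤ 4 * ∫⁻ w in Metric.ball z 1, ‖G w‖ₑ := by
  have hc := hG.continuous
  have e1 : ∫⁻ w in Metric.ball z 1, ‖G w‖ₑ
      = ∫⁻ w, (Metric.ball z 1).indicator (fun w => ‖G w‖ₑ) (z + w) := by
    rw [lintegral_add_left_eq_self, lintegral_indicator Metric.isOpen_ball.measurableSet]
  have e2 : ∫⁻ p in Set.Ioo (1 / 2 : ℝ) 1 ×ˢ Set.Ioo (-Real.pi) Real.pi,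
      ENNReal.ofReal (1 / 2) * ‖G (circleMap z p.1 p.2)‖ₑ
      ≤ ∫⁻ w in Metric.ball z 1, ‖G w‖ₑ := by
    rw [e1, ← Complex.lintegral_comp_polarCoord_symm]
    refine (setLIntegral_mono_ae' (g := fun p => ENNReal.ofReal p.1 •
        (Metric.ball z 1).indicator (fun w => ‖G w‖ₑ) (z + Complex.polarCoord.symm p))
      (measurableSet_Ioo.prod measurableSet_Ioo)
      (Eventually.of_forall ?_)).trans (lintegral_mono_set (μ := volume) ?_)
    · rintro ⟨r, t⟩ ⟨⟨hr1, hr2⟩, -⟩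
      simp only at hr1 hr2
      have h0 : z + Complex.polarCoord.symm (r, t) = circleMap z r t := by
        simp [circleMap, Complex.exp_mul_I]
      simp only [h0, smul_eq_mul]
      rw [Set.indicator_of_mem]
      · exact mul_le_mul' (ENNReal.ofReal_le_ofReal hr1.le) le_rfl
      · rw [Metric.mem_ball, dist_eq_norm, circleMap_sub_center]
        simp [abs_of_pos (show 0 < r by linarith), hr2]
    · exact Set.prod_mono (fun r hr => lt_trans (by norm_num) hr.1) subset_rfl
  have e3 : ENNReal.ofReal (1 / 2) * (‖G z‖ₑ * ENNReal.ofReal (1 / 2))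
      ≤ ∫⁻ w in Metric.ball z 1, ‖G w‖ₑ := by
    refine le_trans ?_ e2
    have hm : Measurable fun p : ℝ × ℝ => ‖G (circleMap z p.1 p.2)‖ₑ := by
      refine (Continuous.enorm (hc.comp ?_)).measurable
      unfold circleMap
      fun_prop
    rw [lintegral_const_mul _ hm, Measure.volume_eq_prod,
      ← Measure.prod_restrict, lintegral_prod _ hm.aemeasurable]
    refine mul_le_mul' le_rfl ?_
    calc ‖G z‖ₑ * ENNReal.ofReal (1 / 2)
        = ∫⁻ _ in Set.Ioo (1 / 2 : ℝ) 1, ‖G z‖ₑ := by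
          rw [setLIntegral_const, Real.volume_Ioo]
          norm_num
      _ ≤ _ := lintegral_mono fun r => enorm_le_circle hG z r
  calc ‖G z‖ₑ = 4 * (ENNReal.ofReal (1 / 2) * (‖G z‖ₑ * ENNReal.ofReal (1 / 2))) := by
        rw [mul_comm ‖G z‖ₑ, ← mul_assoc, ← mul_assoc,
          show (4 : ℝ≥0∞) = ENNReal.ofReal 4 by simp, ← ENNReal.ofReal_mul (by norm_num),
          ← ENNReal.ofReal_mul (by norm_num)]
        norm_num
    _ ≤ _ := mul_le_mul' le_rfl e3

/-- Point evaluations are bounded in the `L²(λ)` norm, uniformly on bounded sets. -/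
theorem exists_enorm_le_eLpNorm (R : ℝ) : ∃ C : ℝ≥0∞, C ≠ ∞ ∧ ∀ F : ℂ → ℂ, Differentiable ℂ F →
    ∀ z ∈ Metric.ball (0 : ℂ) R, ‖F z‖ₑ ≤ C * eLpNorm F 2 gaussianMeasure := by
  set d : ℝ := Real.pi⁻¹ * ((1 / 2) * Real.exp (-(R + 1) ^ 2 / 2)) with hd
  have hd0 : 0 < d := by positivity
  refine ⟨(4 * ENNReal.ofReal d⁻¹) ^ (1 / 2 : ℝ), ?_, fun F hF z hz => ?_⟩
  · exact ENNReal.rpow_ne_top_of_nonneg (by norm_num) (by finiteness)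
  have hR : ‖z‖ < R := by simpa using hz
  have h1 : ‖F z‖ₑ ^ 2 ≤ 4 * ∫⁻ w in Metric.ball z 1, ‖F w‖ₑ ^ 2 := by
    have := enorm_le_ball (G := fun w => F w ^ 2) (hF.pow 2) z
    simpa [enorm_pow] using this
  have h2 : ∫⁻ w in Metric.ball z 1, ‖F w‖ₑ ^ 2
      ≤ ENNReal.ofReal d⁻¹ * ∫⁻ w, ‖F w‖ₑ ^ 2 ∂gaussianMeasure := by
    have hm : Measurable fun w => ‖F w‖ₑ ^ 2 := by
      have := hF.continuous
      fun_prop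
    rw [gaussianMeasure, lintegral_withDensity_eq_lintegral_mul _ (by fun_prop) hm, areaMeasure,
      lintegral_smul_measure, smul_eq_mul, ← mul_assoc, ← lintegral_const_mul _ (by fun_prop)]
    refine le_trans (setLIntegral_mono_ae' Metric.isOpen_ball.measurableSet
      (Eventually.of_forall fun w hw => ?_)) (setLIntegral_le_lintegral _ _)
    have hw' : ‖w‖ ≤ R + 1 := by
      have : ‖w - z‖ < 1 := by simpa [dist_eq_norm] using hw
      calc ‖w‖ = ‖(w - z) + z‖ := by ring_nf
        _ ≤ ‖w - z‖ + ‖z‖ := norm_add_le _ _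
        _ ≤ R + 1 := by linarith
    simp only [Pi.mul_apply]
    rw [← mul_assoc, ← ENNReal.ofReal_mul (by positivity), ← ENNReal.ofReal_mul (by positivity)]
    refine le_mul_of_one_le_left zero_le ?_
    rw [← ENNReal.ofReal_one]
    refine ENNReal.ofReal_le_ofReal ?_
    have : d ≤ Real.pi⁻¹ * ((1 / 2) * Real.exp (-‖w‖ ^ 2 / 2)) := by
      rw [hd]; gcongr
    calc (1 : ℝ) = d⁻¹ * d := (inv_mul_cancel₀ hd0.ne').symm
      _ ≤ d⁻¹ * (Real.pi⁻¹ * ((1 / 2) * Real.exp (-‖w‖ ^ 2 / 2))) := by gcongr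
      _ = _ := by ring
  have h3 : ‖F z‖ₑ ^ 2 ≤ (4 * ENNReal.ofReal d⁻¹) * ∫⁻ w, ‖F w‖ₑ ^ 2 ∂gaussianMeasure := by
    rw [mul_assoc]
    exact h1.trans (mul_le_mul' le_rfl h2)
  rw [eLpNorm_eq_lintegral_rpow_enorm_toReal (by norm_num) (by norm_num)]
  simp only [ENNReal.toReal_ofNat, ENNReal.rpow_ofNat]
  rw [← ENNReal.mul_rpow_of_nonneg _ _ (by norm_num)]
  calc ‖F z‖ₑ = (‖F z‖ₑ ^ 2) ^ (1 / 2 : ℝ) := by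
        rw [← ENNReal.rpow_ofNat, ← ENNReal.rpow_mul]; norm_num
    _ ≤ _ := ENNReal.rpow_le_rpow h3 (by norm_num)

/-- The Fock space `𝓕²`: the subspace of `L²(ℂ, dλ)` formed by the (classes of) entire functions,
with the inner product of `L²(ℂ, dλ)`. -/
def fockSpace : Submodule ℂ (Lp ℂ 2 gaussianMeasure) where
  carrier := {f | ∃ F : ℂ → ℂ, Differentiable ℂ F ∧ ⇑f =ᵐ[gaussianMeasure] F}
  add_mem' := by
    rintro f g ⟨F, hF, hf⟩ ⟨G, hG, hg⟩
    exact ⟨F + G, hF.add hG, (Lp.coeFn_add f g).trans (hf.add hg)⟩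
  zero_mem' := ⟨0, differentiable_const 0, Lp.coeFn_zero _ _ _⟩
  smul_mem' := by
    rintro c f ⟨F, hF, hf⟩
    exact ⟨c • F, hF.const_smul c, (Lp.coeFn_smul c f).trans (hf.const_smul c)⟩

theorem isClosed_fockSpace : IsClosed (fockSpace : Set (Lp ℂ 2 gaussianMeasure)) := by
  refine isSeqClosed_iff_isClosed.mp fun f g hf hfg => ?_
  choose F hF hfF using hf
  have hcau : ∀ R : ℝ, UniformCauchySeqOn F atTop (Metric.ball 0 R) := by
    intro R
    obtain ⟨C, hC, hb⟩ := exists_enorm_le_eLpNorm R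
    rw [Metric.uniformCauchySeqOn_iff]
    intro ε hε
    obtain ⟨N, hN⟩ := Metric.cauchySeq_iff.mp hfg.cauchySeq (ε / (C.toReal + 1)) (by positivity)
    refine ⟨N, fun m hm n hn z hz => ?_⟩
    have h1 := hb (F m - F n) ((hF m).sub (hF n)) z hz
    have h2 : eLpNorm (F m - F n) 2 gaussianMeasure = eLpNorm (⇑(f m - f n)) 2 gaussianMeasure :=
      eLpNorm_congr_ae (((hfF m).sub (hfF n)).symm.trans (Lp.coeFn_sub _ _).symm)
    have h3 : ‖F m z - F n z‖ ≤ C.toReal * ‖f m - f n‖ := by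
      rw [h2, ← Lp.enorm_def] at h1
      have := ENNReal.toReal_mono (by finiteness) h1
      simpa [ENNReal.toReal_mul] using this
    rw [dist_eq_norm]
    have h4 : ‖f m - f n‖ < ε / (C.toReal + 1) := by
      simpa [dist_eq_norm] using hN m hm n hn
    have h5 : (C.toReal + 1) * ‖f m - f n‖ < ε := by
      rw [lt_div_iff₀ (by positivity)] at h4
      linarith
    nlinarith [norm_nonneg (f m - f n)]
  have hlim : ∀ z, ∃ l, Tendsto (fun n => F n z) atTop (𝓝 l) := by
    intro z
    refine cauchySeq_tendsto_of_complete ?_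
    exact ((hcau (‖z‖ + 1)).cauchySeq (x := z) (by simp))
  choose G hG using hlim
  have hloc : TendstoLocallyUniformlyOn F G atTop Set.univ := by
    rw [tendstoLocallyUniformlyOn_iff_forall_isCompact isOpen_univ]
    intro K _ hK
    obtain ⟨R, hR⟩ := hK.isBounded.subset_ball 0
    exact ((hcau R).tendstoUniformlyOn_of_tendsto fun z _ => hG z).mono hR
  refine ⟨G, ?_, ?_⟩
  · rw [← differentiableOn_univ]
    exact hloc.differentiableOn (Eventually.of_forall fun n => (hF n).differentiableOn) isOpen_univ
  · obtain ⟨ns, hns, hae⟩ := (tendstoInMeasure_of_tendsto_Lp hfg).exists_seq_tendsto_ae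
    have hall : ∀ᵐ z ∂gaussianMeasure, ∀ n, f n z = F n z := ae_all_iff.mpr hfF
    filter_upwards [hae, hall] with z hz hz'
    simp only [hz'] at hz
    exact tendsto_nhds_unique hz ((hG z).comp hns.tendsto_atTop)

instance completeSpace_fockSpace : CompleteSpace fockSpace :=
  isClosed_fockSpace.completeSpace_coe

/-- The entire function representing an element of the Fock space. It is unique, because the
Gaussian measure charges every nonempty open set and entire functions are continuous. -/
def entireRep (f : fockSpace) : ℂ → ℂ := Classical.choose f.2

theorem differentiable_entireRep (f : fockSpace) : Differentiable ℂ (entireRep f) :=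
  (Classical.choose_spec f.2).1

theorem coeFn_eq_entireRep (f : fockSpace) :
    ⇑(f : Lp ℂ 2 gaussianMeasure) =ᵐ[gaussianMeasure] entireRep f :=
  (Classical.choose_spec f.2).2

/-- Bounded symbols for the area measure are bounded symbols for the Gaussian measure. -/
theorem memLp_top_gaussian {φ : ℂ → ℂ} (hφ : MemLp φ ∞ areaMeasure) : MemLp φ ∞ gaussianMeasure :=
  ⟨hφ.1.mono_ac gaussianMeasure_absolutelyContinuous, by
    have := hφ.2
    rw [eLpNorm_exponent_top] at this ⊢
    exact (eLpNormEssSup_mono_measure _ gaussianMeasure_absolutelyContinuous).trans_lt this⟩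

/-- The Toeplitz operator `T_φ f = P (φ f)` on the Fock space, where `P` is the orthogonal
projection of `L²(ℂ, dλ)` onto the Fock space and `φ ∈ L^∞(ℂ, dA)`. -/
def toeplitz (φ : ℂ → ℂ) (hφ : MemLp φ ∞ areaMeasure) : fockSpace →L[ℂ] fockSpace :=
  fockSpace.orthogonalProjectionOnto ∘L
    (ContinuousLinearMap.mul ℂ ℂ).holderL gaussianMeasure ∞ 2 2
      ((memLp_top_gaussian hφ).toLp φ) ∘L fockSpace.subtypeL

/-- The reproducing kernel `K_z(w) = exp(z̄ w / 2)` of the Fock space. -/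
def kernel (z w : ℂ) : ℂ := Complex.exp (conj z * w / 2)

/-- The normalized reproducing kernel `k_z = K_z / ‖K_z‖`, where `‖K_z‖ = exp(|z|² / 4)`. -/
def normalizedKernel (z w : ℂ) : ℂ := Complex.exp (w * conj z / 2 - (‖z‖ : ℂ) ^ 2 / 4)

/-- The integrand `f(w) · conj (K_z(w)) · exp(-|w|²/2)` of the Toeplitz operator of a measure. -/
def toeplitzIntegrand (f : ℂ → ℂ) (z w : ℂ) : ℂ :=
  f w * conj (kernel z w) * (Real.exp (-‖w‖ ^ 2 / 2) : ℂ)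

/-- The Toeplitz operator of a measure,
`T_μ f(z) = (1/2) ∫ f(w) conj (K_z(w)) exp(-|w|²/2) dμ(w)`. -/
def toeplitzMeasure (μ : Measure ℂ) (f : ℂ → ℂ) (z : ℂ) : ℂ :=
  (1 / 2) * ∫ w, toeplitzIntegrand f z w ∂μ

/-- The Berezin transform `φ̃(z) = ∫ φ(w) |k_z(w)|² dλ(w)` of a function. -/
def berezin (φ : ℂ → ℝ) (z : ℂ) : ℝ :=
  ∫ w, φ w * ‖normalizedKernel z w‖ ^ 2 ∂gaussianMeasure

/-- The Berezin transform `μ̃(z) = (1/2) ∫ |k_z(w)|² exp(-|w|²/2) dμ(w)` of a positive measure. -/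
def berezinMeasure (μ : Measure ℂ) (z : ℂ) : ℝ≥0∞ :=
  (1 / 2) * ∫⁻ w, ‖normalizedKernel z w‖ₑ ^ 2 * ENNReal.ofReal (Real.exp (-‖w‖ ^ 2 / 2)) ∂μ

/-- `μ` is a reverse Carleson measure for the Fock space: for some `C > 0`,
`∫ |f|² exp(-|w|²/2) dμ ≥ C ∫ |f|² exp(-|w|²/2) dA` for all entire `f ∈ L²(ℂ, dλ)`. -/
def IsReverseCarleson (μ : Measure ℂ) : Prop :=
  ∃ C : ℝ, 0 < C ∧ ∀ f : ℂ → ℂ, Differentiable ℂ f → MemLp f 2 gaussianMeasure →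
    ENNReal.ofReal C *
        ∫⁻ w, ‖f w‖ₑ ^ 2 * ENNReal.ofReal (Real.exp (-‖w‖ ^ 2 / 2)) ∂areaMeasure ≤
      ∫⁻ w, ‖f w‖ₑ ^ 2 * ENNReal.ofReal (Real.exp (-‖w‖ ^ 2 / 2)) ∂μ

/-- The reverse Carleson condition for the Fock space: for some `r > 0` and `C > 0`,
`C⁻¹ ≤ μ(B(z, r)) ≤ C` for all `z`. -/
def ReverseCarlesonCondition (μ : Measure ℂ) : Prop :=
  ∃ r : ℝ, 0 < r ∧ ∃ C : ℝ, 0 < C ∧ ∀ z : ℂ,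
    ENNReal.ofReal C⁻¹ ≤ μ (Metric.ball z r) ∧ μ (Metric.ball z r) ≤ ENNReal.ofReal C

end Fock
end

/-! Everything passes through the quadratic form `∫ φ |f|² dλ = ⟨T_φ f, f⟩`. A lower bound `≥ C
‖f‖²` is statement (d); by Lax–Milgram it makes `T_φ` invertible. Conversely, the projection
contracts and `φ² ≤ Mφ`, so `‖T_φ f‖² ≤ M ∫ φ |f|² dλ`, and invertibility gives (d). Testing (d) on
normalized kernels gives (b). These are Gaussian bumps with a tail uniform in `z`, so with `φ`
bounded (b) forces mass in every disc of a fixed radius, which is (e). If all such discs have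
`μ`-mass bounded below and `φ ≤ M`, then `{φ > s}` meets each of them in area bounded below for
small `s`.

The hard step is (e) ⇒ (c): a set `G` meeting every disc `B(z, R)` in area at least `δ` dominates
the Fock norm (`isReverseCarleson_areaMeasure_restrict`). Call a disc good if the weighted mass of
`f` on `B(z, R + 3)` is at most `K` times that on `B(z, R)`. On a good disc, moved to the origin by
a Weyl translation, the normalized function is uniformly bounded; by compactness it is small only on
a set of area below `δ/2`, so `G` captures a fixed share of the mass. Averaging over `z`, the other
discs cost at most half of the total. -/

noncomputable section
namespace Fock
open Metric Set

/-! ### Normal families and sublevel sets on a fixed disc. -/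

/-- A uniformly bounded sequence of entire functions on a disc has a subsequence converging
uniformly on a smaller concentric disc. -/
theorem exists_subseq_tendstoUniformlyOn {g : ℕ → ℂ → ℂ} {R M : ℝ}
    (hg : ∀ n, Differentiable ℂ (g n)) (hM : ∀ n, ∀ x ∈ closedBall (0 : ℂ) (R + 1), ‖g n x‖ ≤ M) :
    ∃ ns : ℕ → ℕ, StrictMono ns ∧ ∃ G : ℂ → ℂ,
      TendstoUniformlyOn (fun n => g (ns n)) G atTop (closedBall 0 R) := by
  -- The extra unit of radius pays for Cauchy's estimate on unit circles: the derivatives are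
  -- bounded by `M`, whence equicontinuity.
  have hlip : ∀ n, ∀ x ∈ closedBall (0 : ℂ) R, ∀ y ∈ closedBall (0 : ℂ) R,
      ‖g n x - g n y‖ ≤ M * ‖x - y‖ := by
    intro n x hx y hy
    refine (convex_closedBall (0 : ℂ) R).norm_image_sub_le_of_norm_deriv_le
      (fun w _ => (hg n).differentiableAt) (fun w hw => ?_) hy hx
    have h := Complex.norm_deriv_le_of_forall_mem_sphere_norm_le (c := w) (C := M) one_pos
      (hg n).diffContOnCl (fun z hz => hM n z ?_)
    · simpa using h
    · rw [mem_closedBall_zero_iff] at hw ⊢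
      rw [mem_sphere_iff_norm] at hz
      calc ‖z‖ = ‖w + (z - w)‖ := by ring_nf
        _ ≤ ‖w‖ + ‖z - w‖ := norm_add_le _ _
        _ ≤ R + 1 := by linarith
  let K : Type := closedBall (0 : ℂ) R
  have : CompactSpace K := isCompact_iff_compactSpace.mp (isCompact_closedBall _ _)
  let u : ℕ → BoundedContinuousFunction K ℂ := fun n =>
    BoundedContinuousFunction.mkOfCompact
      ⟨fun x : K => g n x.1, (hg n).continuous.comp continuous_subtype_val⟩
  have hcomp : IsCompact (closure (range u)) := by
    refine BoundedContinuousFunction.arzela_ascoli (closedBall (0 : ℂ) M)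
      (isCompact_closedBall _ _) _ ?_ ?_
    · rintro _ x ⟨n, rfl⟩
      rw [mem_closedBall_zero_iff]
      exact hM n x.1 (closedBall_subset_closedBall (by linarith) x.2)
    · refine Metric.equicontinuous_of_continuity_modulus (fun t => M * t) ?_ _ ?_
      · have : Continuous fun t : ℝ => M * t := by fun_prop
        simpa using this.tendsto 0
      · rintro x y ⟨_, n, rfl⟩
        have := hlip n x.1 x.2 y.1 y.2
        rw [← dist_eq_norm, ← dist_eq_norm] at this
        exact this
  obtain ⟨v, -, ns, hns, hlim⟩ :=
    hcomp.tendsto_subseq (x := u) fun n => subset_closure (mem_range_self n)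
  classical
  refine ⟨ns, hns, fun x => if hx : x ∈ closedBall (0 : ℂ) R then v ⟨x, hx⟩ else 0, ?_⟩
  have hunif := BoundedContinuousFunction.tendsto_iff_tendstoUniformly.mp hlim
  rw [Metric.tendstoUniformly_iff] at hunif
  rw [Metric.tendstoUniformlyOn_iff]
  intro ε hε
  filter_upwards [hunif ε hε] with n hn x hx
  simp only [dif_pos hx]
  exact hn ⟨x, hx⟩

/-- Normalized bounded holomorphic functions are small only on sets of small measure,
uniformly over the family. -/
theorem exists_volume_norm_lt_lt {R : ℝ} (M : ℝ) {δ : ℝ≥0∞} (hδ : δ ≠ 0) :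
    ∃ ε : ℝ, 0 < ε ∧ ∀ g : ℂ → ℂ, Differentiable ℂ g →
      (∀ x ∈ closedBall (0 : ℂ) (R + 1), ‖g x‖ ≤ M) →
      ∫⁻ x in ball (0 : ℂ) R, ‖g x‖ₑ ^ 2 = 1 →
      volume ({x | ‖g x‖ < ε} ∩ ball 0 R) < δ := by
  -- Failure for every `ε = 1/(n+1)` yields a normal family; its limit would be small on a set of
  -- measure at least `δ`.
  by_contra! hcon
  choose g hg hM hone hvol using fun n : ℕ => hcon (1 / ((n : ℝ) + 1)) (by positivity)
  obtain ⟨ns, hns, G, hG⟩ := exists_subseq_tendstoUniformlyOn hg hM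
  have hGb := hG.mono ball_subset_closedBall
  have hdiff : DifferentiableOn ℂ G (ball 0 R) :=
    hGb.tendstoLocallyUniformlyOn.differentiableOn
      (Eventually.of_forall fun n => (hg (ns n)).differentiableOn) isOpen_ball
  have hGb' := Metric.tendstoUniformlyOn_iff.mp hGb
  -- the limit does not vanish identically
  obtain ⟨x₀, hx₀, hGx₀⟩ : ∃ x ∈ ball (0 : ℂ) R, G x ≠ 0 := by
    by_contra! hzero
    obtain ⟨η, hη, hη1⟩ : ∃ η : ℝ, 0 < η ∧
        ENNReal.ofReal η ^ 2 * volume (ball (0 : ℂ) R) < 1 := by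
      have hc : Tendsto (fun η : ℝ => ENNReal.ofReal η ^ 2 * volume (ball (0 : ℂ) R))
          (𝓝[>] 0) (𝓝 0) := by
        have h1 : Tendsto (fun η : ℝ => ENNReal.ofReal η ^ 2) (𝓝[>] 0) (𝓝 0) := by
          have : Continuous fun η : ℝ => ENNReal.ofReal η ^ 2 :=
            (ENNReal.continuous_pow 2).comp ENNReal.continuous_ofReal
          simpa using (this.tendsto 0).mono_left nhdsWithin_le_nhds
        simpa using ENNReal.Tendsto.mul_const (b := volume (ball (0 : ℂ) R)) h1
          (Or.inr measure_ball_lt_top.ne)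
      obtain ⟨η, h1, h2⟩ := ((hc.eventually_lt_const one_pos).and self_mem_nhdsWithin).exists
      exact ⟨η, h2, h1⟩
    obtain ⟨n, hn⟩ := (hGb' η hη).exists
    have : ∫⁻ x in ball (0 : ℂ) R, ‖g (ns n) x‖ₑ ^ 2 ≤
        ENNReal.ofReal η ^ 2 * volume (ball (0 : ℂ) R) := by
      rw [← setLIntegral_const]
      refine setLIntegral_mono' measurableSet_ball fun x hx => ?_
      have h := hn x hx
      rw [hzero x hx, dist_zero_left] at h
      gcongr
      rw [← ofReal_norm]
      exact ENNReal.ofReal_le_ofReal h.le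
    rw [hone] at this
    exact absurd hη1 (not_lt.mpr this)
  have hconn : IsConnected (ball (0 : ℂ) R) := ⟨⟨x₀, hx₀⟩, (convex_ball _ _).isPreconnected⟩
  -- Identity theorem: the zeros of a nonzero holomorphic function on a connected set are discrete,
  -- hence null. The sets `S n` below decrease to this zero set.
  have hnull : volume ({x | G x = 0} ∩ ball (0 : ℂ) R) = 0 := by
    have h := ae_restrict_le_codiscreteWithin (μ := (volume : Measure ℂ)) measurableSet_ball
      ((hdiff.analyticOnNhd isOpen_ball).preimage_zero_mem_codiscreteWithin hGx₀ hx₀ hconn)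
    rw [mem_ae_iff, Measure.restrict_apply' measurableSet_ball] at h
    convert h using 2
    ext x; simp
  let S : ℕ → Set ℂ := fun n => ball (0 : ℂ) R ∩ {x | ‖G x‖ < 1 / ((n : ℝ) + 1)}
  have hSopen : ∀ n, IsOpen (S n) := fun n =>
    hdiff.continuousOn.norm.isOpen_inter_preimage isOpen_ball isOpen_Iio
  have hSanti : Antitone S := by
    intro m n hmn x hx
    refine ⟨hx.1, lt_of_lt_of_le (b := 1 / ((n : ℝ) + 1)) hx.2 ?_⟩
    exact one_div_le_one_div_of_le (by positivity) (by exact_mod_cast Nat.succ_le_succ hmn)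
  have hSlim : Tendsto (fun n => volume (S n)) atTop (𝓝 0) := by
    have h := tendsto_measure_iInter_atTop (μ := (volume : Measure ℂ))
      (fun n => (hSopen n).measurableSet.nullMeasurableSet) hSanti
      ⟨0, (measure_mono inter_subset_left).trans_lt
        (measure_ball_lt_top (x := (0 : ℂ)) (r := R)) |>.ne⟩
    have h0 : volume (⋂ n, S n) = 0 := by
      refine measure_mono_null (fun x hx => ?_) hnull
      rw [mem_iInter] at hx
      refine ⟨?_, (hx 0).1⟩
      have : ‖G x‖ ≤ 0 := ge_of_tendsto' tendsto_one_div_add_atTop_nhds_zero_nat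
        fun n => (hx n).2.le
      simpa using this
    rwa [h0] at h
  obtain ⟨N, hN⟩ := (hSlim.eventually_lt_const (pos_iff_ne_zero.mpr hδ)).exists
  set η : ℝ := 1 / ((N : ℝ) + 1) with hηdef
  have hη : 0 < η := by positivity
  -- One half of `η` bounds `g (ns n)` on its sublevel set, the other its distance to `G`, so that
  -- sublevel set lies in `S N`.
  have hev : ∀ᶠ n in atTop, 1 / (((ns n : ℕ) : ℝ) + 1) < η / 2 :=
    (tendsto_one_div_add_atTop_nhds_zero_nat.comp hns.tendsto_atTop).eventually_lt_const
      (half_pos hη)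
  obtain ⟨n, hn1, hn2⟩ := (hev.and (hGb' (η / 2) (half_pos hη))).exists
  refine absurd ((hvol (ns n)).trans (measure_mono (t := S N) ?_)) (not_le.mpr hN)
  rintro x ⟨hx1, hx2⟩
  refine ⟨hx2, ?_⟩
  have h := hn2 x hx2
  rw [dist_eq_norm] at h
  have hx1' : ‖g (ns n) x‖ < 1 / (((ns n : ℕ) : ℝ) + 1) := hx1
  calc ‖G x‖ = ‖(G x - g (ns n) x) + g (ns n) x‖ := by ring_nf
    _ ≤ ‖G x - g (ns n) x‖ + ‖g (ns n) x‖ := norm_add_le _ _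
    _ < η := by linarith

/-- A doubling-type hypothesis lets a set of positive measure control the mass of an entire
function on a disc. -/
theorem exists_mul_lintegral_ball_le {R : ℝ} {K δ : ℝ≥0∞} (hK : K ≠ ∞) (hδ : δ ≠ 0)
    (hδ' : δ ≠ ∞) :
    ∃ c : ℝ≥0∞, c ≠ 0 ∧ c ≠ ∞ ∧ ∀ g : ℂ → ℂ, Differentiable ℂ g → ∀ E : Set ℂ,
      δ ≤ volume (E ∩ ball 0 R) →
      ∫⁻ x in ball (0 : ℂ) (R + 3), ‖g x‖ₑ ^ 2 ≤ K * ∫⁻ x in ball (0 : ℂ) R, ‖g x‖ₑ ^ 2 →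
      c * ∫⁻ x in ball (0 : ℂ) R, ‖g x‖ₑ ^ 2 ≤ ∫⁻ x in E ∩ ball 0 R, ‖g x‖ₑ ^ 2 := by
  -- `enorm_le_ball` applied to the square of the normalized function bounds it by `4K` on the
  -- closed disc of radius `R + 1`, since unit discs centred there stay inside radius `R + 3`.
  set M : ℝ := Real.sqrt (4 * K).toReal with hMdef
  obtain ⟨ε, hε, hsmall⟩ := exists_volume_norm_lt_lt (R := R) M
    (δ := δ / 2) (ENNReal.half_pos hδ).ne'
  refine ⟨ENNReal.ofReal ε ^ 2 * (δ / 2), ?_, by finiteness, fun g hg E hE hgK => ?_⟩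
  · simp [hε, hδ]
  have hc := hg.continuous
  set I := ∫⁻ x in ball (0 : ℂ) R, ‖g x‖ₑ ^ 2 with hI
  rcases eq_or_ne I 0 with hI0 | hI0
  · simp [hI0]
  have hItop : I ≠ ∞ := by
    obtain ⟨B, hB⟩ := (isCompact_closedBall (0 : ℂ) R).exists_bound_of_continuousOn hc.continuousOn
    refine ne_top_of_le_ne_top (b := ENNReal.ofReal B ^ 2 * volume (ball (0 : ℂ) R)) ?_ ?_
    · exact ENNReal.mul_ne_top (by finiteness) measure_ball_lt_top.ne
    · rw [hI, ← setLIntegral_const]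
      refine setLIntegral_mono' measurableSet_ball fun x hx => ?_
      gcongr
      rw [← ofReal_norm]
      exact ENNReal.ofReal_le_ofReal (hB x (ball_subset_closedBall hx))
  -- normalize
  set s : ℝ := Real.sqrt I.toReal⁻¹ with hs
  have hIpos : 0 < I.toReal := ENNReal.toReal_pos hI0 hItop
  have hs2 : ‖(s : ℂ)‖ₑ ^ 2 = I⁻¹ := by
    rw [← ofReal_norm, Complex.norm_real, Real.norm_of_nonneg (Real.sqrt_nonneg _),
      ← ENNReal.ofReal_pow (Real.sqrt_nonneg _), Real.sq_sqrt (by positivity),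
      ENNReal.ofReal_inv_of_pos hIpos, ENNReal.ofReal_toReal hItop]
  set h : ℂ → ℂ := fun x => s * g x with hh
  have hhd : Differentiable ℂ h := hg.const_mul _
  have hhn : ∀ x, ‖h x‖ₑ ^ 2 = I⁻¹ * ‖g x‖ₑ ^ 2 := fun x => by
    rw [hh]; simp only [enorm_mul, mul_pow, hs2]
  have hint : ∀ A : Set ℂ, ∫⁻ x in A, ‖h x‖ₑ ^ 2 = I⁻¹ * ∫⁻ x in A, ‖g x‖ₑ ^ 2 := fun A => by
    simp only [hhn]
    rw [lintegral_const_mul _ (by fun_prop)]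
  have hvol := hsmall h hhd ?_ ?_
  · have hm : Measurable fun x => ‖h x‖ₑ ^ 2 := by
      have := hhd.continuous
      fun_prop
    -- Chebyshev's inequality, on the part of `E` where `|h| ≥ ε`; removing the sublevel set from
    -- `E` leaves measure at least `δ/2`.
    have h1 := mul_meas_ge_le_lintegral (μ := volume.restrict (E ∩ ball 0 R)) hm
      (ENNReal.ofReal ε ^ 2)
    rw [Measure.restrict_apply (measurableSet_le measurable_const hm), hint] at h1
    have h2 : δ / 2 ≤ volume ({x | ENNReal.ofReal ε ^ 2 ≤ ‖h x‖ₑ ^ 2} ∩ (E ∩ ball 0 R)) := by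
      have h3 : volume (E ∩ ball 0 R) - volume ({x | ‖h x‖ < ε} ∩ ball 0 R) ≤
          volume ({x | ENNReal.ofReal ε ^ 2 ≤ ‖h x‖ₑ ^ 2} ∩ (E ∩ ball 0 R)) := by
        refine le_measure_sdiff.trans (measure_mono ?_)
        rintro x ⟨hx1, hx2⟩
        refine ⟨?_, hx1⟩
        have : ε ≤ ‖h x‖ := by
          by_contra! hlt
          exact hx2 ⟨hlt, hx1.2⟩
        change ENNReal.ofReal ε ^ 2 ≤ ‖h x‖ₑ ^ 2
        gcongr
        rw [← ofReal_norm]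
        exact ENNReal.ofReal_le_ofReal this
      refine le_trans ?_ h3
      calc δ / 2 = δ - δ / 2 := (ENNReal.sub_half hδ').symm
        _ ≤ _ := tsub_le_tsub hE hvol.le
    calc ENNReal.ofReal ε ^ 2 * (δ / 2) * I
        ≤ I⁻¹ * (∫⁻ x in E ∩ ball 0 R, ‖g x‖ₑ ^ 2) * I :=
          mul_le_mul' ((mul_le_mul' le_rfl h2).trans h1) le_rfl
      _ = (I⁻¹ * I) * ∫⁻ x in E ∩ ball 0 R, ‖g x‖ₑ ^ 2 := by ring
      _ = _ := by rw [ENNReal.inv_mul_cancel hI0 hItop, one_mul]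
  · intro x hx
    have hb := enorm_le_ball (G := fun w => h w ^ 2) (hhd.pow 2) x
    simp only [enorm_pow] at hb
    have h4 : ‖h x‖ₑ ^ 2 ≤ 4 * K := by
      refine hb.trans (mul_le_mul' le_rfl ?_)
      calc ∫⁻ w in ball x 1, ‖h w‖ₑ ^ 2 ≤ ∫⁻ w in ball (0 : ℂ) (R + 3), ‖h w‖ₑ ^ 2 := by
            refine lintegral_mono_set (ball_subset_ball' ?_)
            rw [mem_closedBall] at hx
            linarith
        _ ≤ I⁻¹ * (K * I) := by rw [hint]; gcongr
        _ = K * (I⁻¹ * I) := by ring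
        _ = K := by rw [ENNReal.inv_mul_cancel hI0 hItop, mul_one]
    refine Real.le_sqrt_of_sq_le ?_
    have h5 := ENNReal.toReal_mono (by finiteness) h4
    simpa using h5
  · rw [hint, ← hI, ENNReal.inv_mul_cancel hI0 hItop]

/-! ### Weyl translations and the Gaussian weight. -/

/-- The weighted square modulus `|f(w)|² exp(-|w|²/2)`. -/
def weightedSq (f : ℂ → ℂ) (w : ℂ) : ℝ≥0∞ :=
  ‖f w‖ₑ ^ 2 * ENNReal.ofReal (Real.exp (-‖w‖ ^ 2 / 2))

theorem measurable_weightedSq {f : ℂ → ℂ} (hf : Measurable f) : Measurable (weightedSq f) := by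
  unfold weightedSq
  fun_prop

/-- The Weyl translation of an entire function. -/
def weyl (z : ℂ) (f : ℂ → ℂ) (w : ℂ) : ℂ :=
  f (w + z) * Complex.exp (-(conj z * w) / 2 - (‖z‖ : ℂ) ^ 2 / 4)

theorem differentiable_weyl (z : ℂ) {f : ℂ → ℂ} (hf : Differentiable ℂ f) :
    Differentiable ℂ (weyl z f) := by
  unfold weyl
  fun_prop

/-- The modulus of the exponential factor completes the square `|w|² + 2 Re(z̄w) + |z|² = |w + z|²`.
Hence every disc can be moved to the origin. -/
theorem weightedSq_weyl (z : ℂ) (f : ℂ → ℂ) (w : ℂ) :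
    weightedSq (weyl z f) w = weightedSq f (w + z) := by
  unfold weightedSq weyl
  rw [enorm_mul, mul_pow, mul_assoc]
  congr 1
  rw [← ofReal_norm, Complex.norm_exp, ← ENNReal.ofReal_pow (Real.exp_pos _).le,
    ← ENNReal.ofReal_mul (by positivity), ← Real.exp_nat_mul, ← Real.exp_add]
  congr 2
  have h : ((‖z‖ : ℂ) ^ 2).re = ‖z‖ ^ 2 := by norm_cast
  simp only [Complex.sub_re, Complex.div_ofNat_re, h, Complex.neg_re, Complex.mul_re,
    Complex.conj_re, Complex.conj_im, Complex.sq_norm, Complex.normSq_apply, Complex.add_re,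
    Complex.add_im]
  push_cast
  ring

theorem setLIntegral_comp_add_right (u : ℂ → ℝ≥0∞) (A : Set ℂ) (z : ℂ) :
    ∫⁻ w in (fun w => w + z) ⁻¹' A, u (w + z) = ∫⁻ w in A, u w :=
  (measurePreserving_add_right volume z).setLIntegral_comp_preimage_emb
    (measurableEmbedding_addRight z) u A

theorem preimage_add_right_ball (z : ℂ) (r : ℝ) :
    (fun w => w + z) ⁻¹' ball z r = ball (0 : ℂ) r := by
  ext w; simp [dist_eq_norm]

/-- The weighted, translated form of `exists_mul_lintegral_ball_le`. -/
theorem exists_mul_lintegral_weightedSq_le {R : ℝ} {K δ : ℝ≥0∞} (hK : K ≠ ∞)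
    (hδ : δ ≠ 0) (hδ' : δ ≠ ∞) :
    ∃ c : ℝ≥0∞, c ≠ 0 ∧ c ≠ ∞ ∧ ∀ f : ℂ → ℂ, Differentiable ℂ f → ∀ (z : ℂ) (E : Set ℂ),
      δ ≤ volume (E ∩ ball z R) →
      ∫⁻ x in ball z (R + 3), weightedSq f x ≤ K * ∫⁻ x in ball z R, weightedSq f x →
      c * ∫⁻ x in ball z R, weightedSq f x ≤ ∫⁻ x in E ∩ ball z R, weightedSq f x := by
  -- On the disc of radius `R + 3` about the origin the weight lies between `m` and 1, so dropping
  -- it turns `K` into `m⁻¹ * K`.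
  set m : ℝ≥0∞ := ENNReal.ofReal (Real.exp (-(R + 3) ^ 2 / 2)) with hm
  have hm0 : m ≠ 0 := by simp [hm, Real.exp_pos]
  have hmt : m ≠ ∞ := ENNReal.ofReal_ne_top
  obtain ⟨c, hc0, hct, hc⟩ := exists_mul_lintegral_ball_le (R := R) (K := m⁻¹ * K)
    (by finiteness) hδ hδ'
  refine ⟨m * c, mul_ne_zero hm0 hc0, by finiteness, fun f hf z E hE hfK => ?_⟩
  set g := weyl z f with hg
  have hgd : Differentiable ℂ g := differentiable_weyl z hf
  have hgc := hgd.continuous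
  have hgm : Measurable fun x => ‖g x‖ₑ ^ 2 := by fun_prop
  have hle : ∀ x, weightedSq g x ≤ ‖g x‖ₑ ^ 2 := fun x => by
    unfold weightedSq
    refine mul_le_of_le_one_right' ?_
    rw [← ENNReal.ofReal_one]
    refine ENNReal.ofReal_le_ofReal (Real.exp_le_one_iff.mpr ?_)
    have := sq_nonneg ‖x‖
    linarith
  have hge : ∀ x ∈ ball (0 : ℂ) (R + 3), ‖g x‖ₑ ^ 2 ≤ m⁻¹ * weightedSq g x := fun x hx => by
    rw [mem_ball_zero_iff] at hx
    have h1 : m * ‖g x‖ₑ ^ 2 ≤ weightedSq g x := by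
      rw [weightedSq, mul_comm]
      refine mul_le_mul' le_rfl (ENNReal.ofReal_le_ofReal (Real.exp_le_exp.mpr ?_))
      have : ‖x‖ ^ 2 ≤ (R + 3) ^ 2 := by gcongr
      linarith
    calc ‖g x‖ₑ ^ 2 = m⁻¹ * (m * ‖g x‖ₑ ^ 2) := by
          rw [← mul_assoc, ENNReal.inv_mul_cancel hm0 hmt, one_mul]
      _ ≤ _ := mul_le_mul' le_rfl h1
  have htr : ∀ A : Set ℂ, ∫⁻ x in (fun w => w + z) ⁻¹' A, weightedSq g x =
      ∫⁻ x in A, weightedSq f x := fun A => by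
    simp only [hg, weightedSq_weyl]
    exact setLIntegral_comp_add_right (weightedSq f) A z
  set E' := (fun w => w + z) ⁻¹' E with hE'
  have hEvol : δ ≤ volume (E' ∩ ball 0 R) := by
    rw [← preimage_add_right_ball z R, hE', ← preimage_inter]
    exact hE.trans_eq (measure_preimage_add_right volume z _).symm
  have h1 := hc g hgd E' hEvol ?_
  · rw [← htr (E ∩ ball z R), ← htr (ball z R), preimage_inter, preimage_add_right_ball]
    calc m * c * ∫⁻ x in ball 0 R, weightedSq g x
        ≤ m * (c * ∫⁻ x in ball 0 R, ‖g x‖ₑ ^ 2) := by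
          rw [mul_assoc]
          exact mul_le_mul' le_rfl (mul_le_mul' le_rfl (lintegral_mono hle))
      _ ≤ m * ∫⁻ x in E' ∩ ball 0 R, ‖g x‖ₑ ^ 2 := mul_le_mul' le_rfl h1
      _ ≤ m * ∫⁻ x in E' ∩ ball 0 R, m⁻¹ * weightedSq g x := by
          refine mul_le_mul' le_rfl (lintegral_mono_ae ?_)
          -- `E` need not be measurable, so only membership in the ball is used.
          refine ae_mono (Measure.restrict_mono inter_subset_right le_rfl) ?_
          filter_upwards [ae_restrict_mem measurableSet_ball] with x hx
          exact hge x (ball_subset_ball (by linarith) hx)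
      _ = ∫⁻ x in E' ∩ ball 0 R, weightedSq g x := by
          rw [lintegral_const_mul _ (measurable_weightedSq hgc.measurable), ← mul_assoc,
            ENNReal.mul_inv_cancel hm0 hmt, one_mul]
  · rw [← htr, ← htr, preimage_add_right_ball, preimage_add_right_ball] at hfK
    calc ∫⁻ x in ball 0 (R + 3), ‖g x‖ₑ ^ 2
        ≤ ∫⁻ x in ball 0 (R + 3), m⁻¹ * weightedSq g x :=
          setLIntegral_mono' measurableSet_ball hge
      _ = m⁻¹ * ∫⁻ x in ball 0 (R + 3), weightedSq g x :=
          lintegral_const_mul _ (measurable_weightedSq hgc.measurable)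
      _ ≤ m⁻¹ * (K * ∫⁻ x in ball 0 R, weightedSq g x) := mul_le_mul' le_rfl hfK
      _ ≤ m⁻¹ * (K * ∫⁻ x in ball 0 R, ‖g x‖ₑ ^ 2) :=
          mul_le_mul' le_rfl (mul_le_mul' le_rfl (lintegral_mono hle))
      _ = _ := (mul_assoc _ _ _).symm

/-! ### Averaging over discs: dominating sets. -/

/-- Tonelli: the centres `z` of discs of radius `ρ` containing `w` fill the disc `ball w ρ`. -/
theorem lintegral_setLIntegral_ball (ν : Measure ℂ) [SFinite ν] {u : ℂ → ℝ≥0∞}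
    (hu : Measurable u) (ρ : ℝ) :
    ∫⁻ z, ∫⁻ w in ball z ρ, u w ∂ν = volume (ball (0 : ℂ) ρ) * ∫⁻ w, u w ∂ν := by
  have hS : MeasurableSet {p : ℂ × ℂ | dist p.2 p.1 < ρ} :=
    (isOpen_lt (by fun_prop) continuous_const).measurableSet
  have h1 : ∀ z, ∫⁻ w in ball z ρ, u w ∂ν =
      ∫⁻ w, {p : ℂ × ℂ | dist p.2 p.1 < ρ}.indicator (fun p => u p.2) (z, w) ∂ν := fun z => by
    rw [← lintegral_indicator measurableSet_ball]
    rfl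
  have h2 : ∀ w, ∫⁻ z, {p : ℂ × ℂ | dist p.2 p.1 < ρ}.indicator (fun p => u p.2) (z, w) =
      volume (ball (0 : ℂ) ρ) * u w := fun w => by
    have : ∀ z, {p : ℂ × ℂ | dist p.2 p.1 < ρ}.indicator (fun p => u p.2) (z, w) =
        (ball w ρ).indicator (fun _ => u w) z := fun z => by
      simp only [indicator, mem_ofPred_eq, mem_ball, dist_comm w z]
    simp only [this]
    rw [lintegral_indicator measurableSet_ball, setLIntegral_const, mul_comm,
      Measure.addHaar_ball_center]
  simp only [h1]
  rw [lintegral_lintegral_swap]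
  · simp only [h2]
    exact lintegral_const_mul _ hu
  · exact ((hu.comp measurable_snd).indicator hS).aemeasurable

theorem lintegral_gaussianMeasure (u : ℂ → ℝ≥0∞) :
    ∫⁻ w, u w ∂gaussianMeasure =
      2⁻¹ * ∫⁻ w, u w * ENNReal.ofReal (Real.exp (-‖w‖ ^ 2 / 2)) ∂areaMeasure := by
  rw [gaussianMeasure, lintegral_withDensity_eq_lintegral_mul_non_measurable _ (by fun_prop)
    (Eventually.of_forall fun _ => ENNReal.ofReal_lt_top),
    ← lintegral_const_mul' _ _ (by simp)]
  refine lintegral_congr fun w => ?_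
  simp only [Pi.mul_apply]
  rw [ENNReal.ofReal_mul (by norm_num), mul_comm (u w), ← mul_assoc]
  congr 2
  rw [one_div, ENNReal.ofReal_inv_of_pos (by norm_num)]
  simp

theorem lintegral_areaMeasure (u : ℂ → ℝ≥0∞) :
    ∫⁻ w, u w ∂areaMeasure = ENNReal.ofReal Real.pi⁻¹ * ∫⁻ w, u w := by
  rw [areaMeasure, lintegral_smul_measure, smul_eq_mul]

theorem lintegral_sq_ne_top {μ : Measure ℂ} {f : ℂ → ℂ} (hf : MemLp f 2 μ) :
    ∫⁻ w, ‖f w‖ₑ ^ 2 ∂μ ≠ ∞ := by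
  have := hf.2
  rw [eLpNorm_lt_top_iff_lintegral_rpow_enorm_lt_top (by norm_num) (by norm_num)] at this
  simpa using this.ne

theorem lintegral_weightedSq_ne_top {f : ℂ → ℂ} (hf : MemLp f 2 gaussianMeasure) :
    ∫⁻ w, weightedSq f w ≠ ∞ := by
  have h := lintegral_sq_ne_top hf
  rw [lintegral_gaussianMeasure, lintegral_areaMeasure] at h
  intro htop
  change (2 : ℝ≥0∞)⁻¹ * (_ * ∫⁻ w, weightedSq f w) ≠ ∞ at h
  rw [htop] at h
  refine h ?_
  rw [ENNReal.mul_top (by simp [Real.pi_pos]), ENNReal.mul_top (by simp)]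

/-- A set whose intersections with all discs of some fixed radius have area bounded below
is dominating for the Fock space. -/
theorem isReverseCarleson_areaMeasure_restrict {G : Set ℂ} {R : ℝ} (hR : 0 < R) {δ : ℝ≥0∞}
    (hδ : δ ≠ 0) (hG : ∀ z, δ ≤ volume (G ∩ ball z R)) :
    IsReverseCarleson (areaMeasure.restrict G) := by
  have hδ' : δ ≠ ∞ := ne_top_of_le_ne_top
    (measure_ball_lt_top (μ := (volume : Measure ℂ)) (x := 0) (r := R)).ne
    ((hG 0).trans (measure_mono inter_subset_right))
  set v := volume (ball (0 : ℂ) R) with hv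
  set V := volume (ball (0 : ℂ) (R + 3)) with hV
  have hv0 : v ≠ 0 := (measure_ball_pos _ _ hR).ne'
  have hvt : v ≠ ∞ := measure_ball_lt_top.ne
  have hV0 : V ≠ 0 := (measure_ball_pos _ _ (by linarith)).ne'
  have hVt : V ≠ ∞ := measure_ball_lt_top.ne
  -- Chosen so that `c * K⁻¹ * V = c / 2 * v`: after averaging, the bad discs account for half of
  -- the left side.
  set K : ℝ≥0∞ := 2 * V / v with hK
  have hK0 : K ≠ 0 := ENNReal.div_ne_zero.mpr ⟨mul_ne_zero (by simp) hV0, hvt⟩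
  have hKt : K ≠ ∞ := ENNReal.div_ne_top (by finiteness) hv0
  obtain ⟨c, hc0, hct, hc⟩ := exists_mul_lintegral_weightedSq_le hKt hδ hδ'
  refine ⟨(c / 2).toReal, ENNReal.toReal_pos (ENNReal.div_ne_zero.mpr ⟨hc0, by simp⟩)
    (ENNReal.div_ne_top hct (by simp)), fun f hf hfL => ?_⟩
  rw [ENNReal.ofReal_toReal (ENNReal.div_ne_top hct (by simp))]
  change _ * ∫⁻ w, weightedSq f w ∂areaMeasure ≤ ∫⁻ w, weightedSq f w ∂areaMeasure.restrict G
  have hum : Measurable (weightedSq f) := measurable_weightedSq hf.continuous.measurable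
  set I := ∫⁻ w, weightedSq f w with hI
  set J := ∫⁻ w in G, weightedSq f w with hJ
  have hIt : I ≠ ∞ := lintegral_weightedSq_ne_top hfL
  have hpt : ∀ z, c * ∫⁻ w in ball z R, weightedSq f w ≤
      (∫⁻ w in ball z R, weightedSq f w ∂(volume.restrict G)) +
        c * K⁻¹ * ∫⁻ w in ball z (R + 3), weightedSq f w := by
    intro z
    -- Good disc: the local estimate applies. Bad disc: the larger disc dominates by definition.
    rcases le_total (∫⁻ w in ball z (R + 3), weightedSq f w)
      (K * ∫⁻ w in ball z R, weightedSq f w) with h | h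
    · refine le_trans ?_ le_self_add
      rw [Measure.restrict_restrict measurableSet_ball, inter_comm]
      exact hc f hf z G (hG z) h
    · refine le_trans ?_ le_add_self
      rw [mul_assoc]
      refine mul_le_mul' le_rfl ?_
      calc ∫⁻ w in ball z R, weightedSq f w
          = K⁻¹ * (K * ∫⁻ w in ball z R, weightedSq f w) := by
            rw [← mul_assoc, ENNReal.inv_mul_cancel hK0 hKt, one_mul]
        _ ≤ _ := mul_le_mul' le_rfl h
  have hmeas : ∀ (ν : Measure ℂ) [SFinite ν] (ρ : ℝ),
      Measurable fun z => ∫⁻ w in ball z ρ, weightedSq f w ∂ν := by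
    intro ν _ ρ
    have hS : MeasurableSet {p : ℂ × ℂ | dist p.2 p.1 < ρ} :=
      (isOpen_lt (by fun_prop) continuous_const).measurableSet
    have := ((hum.comp measurable_snd).indicator hS).lintegral_prod_right' (ν := ν)
    convert this using 2 with z
    rw [← lintegral_indicator measurableSet_ball]
    rfl
  have hint := lintegral_mono (μ := volume) hpt
  rw [lintegral_const_mul _ (hmeas _ _), lintegral_add_left (hmeas _ _),
    lintegral_const_mul _ (hmeas _ _), lintegral_setLIntegral_ball _ hum,
    lintegral_setLIntegral_ball _ hum, lintegral_setLIntegral_ball _ hum, ← hI, ← hJ, ← hv,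
    ← hV] at hint
  have hKV : c * K⁻¹ * (V * I) = c / 2 * (v * I) := by
    rw [hK, ENNReal.inv_div (Or.inl hvt) (Or.inl hv0), ENNReal.div_eq_inv_mul,
      ENNReal.mul_inv (by simp) (by simp), ENNReal.div_eq_inv_mul]
    calc c * (2⁻¹ * V⁻¹ * v) * (V * I) = (V⁻¹ * V) * (2⁻¹ * c * (v * I)) := by ring
      _ = _ := by rw [ENNReal.inv_mul_cancel hV0 hVt, one_mul]
  rw [hKV] at hint
  have hsplit : c * (v * I) = c / 2 * (v * I) + c / 2 * (v * I) := by
    rw [← add_mul, ENNReal.add_halves]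
  rw [hsplit] at hint
  -- Finiteness, from `f ∈ L²`, permits subtracting this term from both sides.
  have hfin : c / 2 * (v * I) ≠ ∞ :=
    ENNReal.mul_ne_top (ENNReal.div_ne_top hct (by simp)) (ENNReal.mul_ne_top hvt hIt)
  have h3 : c / 2 * (v * I) ≤ v * J := (ENNReal.add_le_add_iff_right hfin).mp hint
  have h4 : c / 2 * I ≤ J := by
    rw [← mul_assoc, mul_comm (c / 2), mul_assoc] at h3
    exact (ENNReal.mul_le_mul_iff_right hv0 hvt).mp h3
  rw [areaMeasure, Measure.restrict_smul, lintegral_smul_measure, lintegral_smul_measure,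
    smul_eq_mul, smul_eq_mul, ← hI, ← hJ]
  calc c / 2 * (ENNReal.ofReal Real.pi⁻¹ * I) = ENNReal.ofReal Real.pi⁻¹ * (c / 2 * I) := by ring
    _ ≤ _ := mul_le_mul' le_rfl h4

/-! ### Rotation invariance, mean values and the reproducing kernel. -/

theorem measurePreserving_mul_areaMeasure {c : ℂ} (hc : ‖c‖ = 1) :
    MeasurePreserving (fun w => c * w) areaMeasure areaMeasure := by
  have h : MeasurePreserving (rotation ⟨c, mem_sphere_zero_iff_norm.mpr hc⟩) volume volume :=
    LinearIsometryEquiv.measurePreserving _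
  exact h.smul_measure _

theorem measurePreserving_mul_gaussianMeasure {c : ℂ} (hc : ‖c‖ = 1) :
    MeasurePreserving (fun w => c * w) gaussianMeasure gaussianMeasure := by
  have hm := measurePreserving_mul_areaMeasure hc
  refine ⟨hm.measurable, Measure.ext fun s hs => ?_⟩
  rw [Measure.map_apply hm.measurable hs, gaussianMeasure,
    withDensity_apply _ (hm.measurable hs), withDensity_apply _ hs,
    ← hm.setLIntegral_comp_preimage hs (by fun_prop)]
  simp only [norm_mul, hc, one_mul]

theorem lintegral_exp_areaMeasure :
    ∫⁻ w, ENNReal.ofReal (Real.exp (-‖w‖ ^ 2 / 2)) ∂areaMeasure = 2 := by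
  have h := GaussianFourier.integral_rexp_neg_mul_sq_norm (V := ℂ) (b := 1 / 2) (by norm_num)
  have h' : ∫ w : ℂ, Real.exp (-‖w‖ ^ 2 / 2) = 2 * Real.pi := by
    rw [show (fun w : ℂ => Real.exp (-‖w‖ ^ 2 / 2)) =
      fun w : ℂ => Real.exp (-(1 / 2) * ‖w‖ ^ 2) by ext w; ring_nf, h]
    simp [Complex.finrank_real_complex]
    ring
  -- A non-integrable function has integral 0 by convention, whereas this one is `2π`.
  have hi : Integrable fun w : ℂ => Real.exp (-‖w‖ ^ 2 / 2) := by
    by_contra hcon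
    rw [integral_undef hcon] at h'
    linarith [Real.pi_pos]
  rw [lintegral_areaMeasure, ← ofReal_integral_eq_lintegral_ofReal hi
    (Eventually.of_forall fun w => (Real.exp_pos _).le), h',
    ← ENNReal.ofReal_mul (by positivity), mul_comm 2, ← mul_assoc,
    inv_mul_cancel₀ Real.pi_pos.ne', one_mul]
  simp

instance isProbabilityMeasure_gaussianMeasure : IsProbabilityMeasure gaussianMeasure := ⟨by
  have h := lintegral_gaussianMeasure 1
  simp only [Pi.one_apply, lintegral_one, one_mul] at h
  rw [h, lintegral_exp_areaMeasure]
  exact ENNReal.inv_mul_cancel (by simp) (by simp)⟩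

/-- The mean value property of entire functions for the Gaussian measure. -/
theorem integral_gaussianMeasure_eq {h : ℂ → ℂ} (hd : Differentiable ℂ h)
    (hi : Integrable h gaussianMeasure) : ∫ w, h w ∂gaussianMeasure = h 0 := by
  have hc := hd.continuous
  have hnorm : ∀ t : ℝ, ‖circleMap 0 1 t‖ = 1 := fun t => by simp
  -- Fubini for `h(e^{it} w)`: integrating in `t` first gives `2π h(0)` by the mean value property,
  -- integrating in `w` first gives `∫ h dλ` for each `t` by rotation invariance.
  have hcirc : ∀ w, ∫ t in Ioc 0 (2 * Real.pi), h (circleMap 0 1 t * w) =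
      (2 * Real.pi : ℝ) • h 0 := by
    intro w
    have hd' : Differentiable ℂ fun ζ => h (ζ * w) := by fun_prop
    have h1 : Real.circleAverage (fun ζ => h (ζ * w)) 0 1 = h 0 := by
      have := DiffContOnCl.circleAverage (c := 0) (R := 1) hd'.diffContOnCl
      rwa [zero_mul] at this
    rw [Real.circleAverage_def, intervalIntegral.integral_of_le (by positivity)] at h1
    rw [← h1, smul_smul, mul_inv_cancel₀ (by positivity), one_smul]
  have hjoint : Integrable (Function.uncurry fun w t => h (circleMap 0 1 t * w))
      (gaussianMeasure.prod (volume.restrict (Ioc 0 (2 * Real.pi)))) := by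
    have hcont : Continuous (Function.uncurry fun w t => h (circleMap 0 1 t * w)) := by
      unfold Function.uncurry circleMap
      fun_prop
    rw [integrable_prod_iff' hcont.aestronglyMeasurable]
    refine ⟨Eventually.of_forall fun t =>
      (measurePreserving_mul_gaussianMeasure (hnorm t)).integrable_comp_of_integrable hi, ?_⟩
    have : ∀ t, ∫ w, ‖Function.uncurry (fun w t => h (circleMap 0 1 t * w)) (w, t)‖
        ∂gaussianMeasure = ∫ w, ‖h w‖ ∂gaussianMeasure := fun t =>
      (measurePreserving_mul_gaussianMeasure (hnorm t)).integral_comp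
        (measurableEmbedding_mulLeft₀ (by simp)) fun w => ‖h w‖
    simp only [this]
    exact integrable_const _
  have hswap := integral_integral_swap hjoint
  simp only [hcirc] at hswap
  have hrot : ∀ t, ∫ w, h (circleMap 0 1 t * w) ∂gaussianMeasure = ∫ w, h w ∂gaussianMeasure :=
    fun t => (measurePreserving_mul_gaussianMeasure (hnorm t)).integral_comp
      (measurableEmbedding_mulLeft₀ (by simp)) h
  simp only [hrot, integral_const, probReal_univ, one_smul, measureReal_restrict_apply_univ,
    Real.volume_real_Ioc_of_le (show (0 : ℝ) ≤ 2 * Real.pi by positivity), sub_zero] at hswap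
  exact (smul_right_injective ℂ (show (2 * Real.pi : ℝ) ≠ 0 by positivity) hswap).symm

theorem memLp_two_of_lintegral_weightedSq {f : ℂ → ℂ} (hf : Continuous f)
    (h : ∫⁻ w, weightedSq f w ≠ ∞) : MemLp f 2 gaussianMeasure := by
  refine ⟨hf.aestronglyMeasurable, ?_⟩
  rw [eLpNorm_lt_top_iff_lintegral_rpow_enorm_lt_top (by norm_num) (by norm_num)]
  simp only [ENNReal.toReal_ofNat, ENNReal.rpow_ofNat]
  rw [lintegral_gaussianMeasure, lintegral_areaMeasure]
  change (2 : ℝ≥0∞)⁻¹ * (_ * ∫⁻ w, weightedSq f w) < ∞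
  exact ENNReal.mul_lt_top (by simp) (ENNReal.mul_lt_top (by simp) h.lt_top)

theorem memLp_weyl (z : ℂ) {f : ℂ → ℂ} (hf : Differentiable ℂ f)
    (h : MemLp f 2 gaussianMeasure) : MemLp (weyl z f) 2 gaussianMeasure := by
  refine memLp_two_of_lintegral_weightedSq (differentiable_weyl z hf).continuous ?_
  simp only [weightedSq_weyl]
  rw [lintegral_add_right_eq_self]
  exact lintegral_weightedSq_ne_top h

/-- Integrability and the weighted modulus of the normalized kernel are thus inherited from the
constant function 1. -/
theorem normalizedKernel_eq_weyl (z : ℂ) : normalizedKernel z = weyl (-z) 1 := by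
  ext w
  simp only [normalizedKernel, weyl, Pi.one_apply, map_neg, norm_neg]
  ring_nf

theorem differentiable_normalizedKernel (z : ℂ) : Differentiable ℂ (normalizedKernel z) := by
  unfold normalizedKernel
  fun_prop

theorem memLp_normalizedKernel (z : ℂ) : MemLp (normalizedKernel z) 2 gaussianMeasure := by
  rw [normalizedKernel_eq_weyl]
  exact memLp_weyl _ (differentiable_const 1) (memLp_const 1)

theorem weightedSq_normalizedKernel (z w : ℂ) :
    weightedSq (normalizedKernel z) w = ENNReal.ofReal (Real.exp (-‖w - z‖ ^ 2 / 2)) := by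
  rw [normalizedKernel_eq_weyl, weightedSq_weyl]
  simp [weightedSq, sub_eq_add_neg]

theorem lintegral_weightedSq_normalizedKernel (z : ℂ) :
    ∫⁻ w, weightedSq (normalizedKernel z) w ∂areaMeasure = 2 := by
  simp only [weightedSq_normalizedKernel]
  rw [← lintegral_exp_areaMeasure, lintegral_areaMeasure, lintegral_areaMeasure,
    lintegral_sub_right_eq_self (fun w : ℂ => ENNReal.ofReal (Real.exp (-‖w‖ ^ 2 / 2)))]

theorem differentiable_kernel (z : ℂ) : Differentiable ℂ (kernel z) := by
  unfold kernel
  fun_prop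

theorem memLp_kernel (z : ℂ) : MemLp (kernel z) 2 gaussianMeasure := by
  have h : kernel z = fun w => Complex.exp ((‖z‖ : ℂ) ^ 2 / 4) * normalizedKernel z w := by
    ext w
    rw [kernel, normalizedKernel, ← Complex.exp_add]
    ring_nf
  rw [h]
  exact (memLp_normalizedKernel z).const_mul _

theorem integral_gaussianMeasure (g : ℂ → ℂ) :
    ∫ w, g w ∂gaussianMeasure =
      (1 / 2) * ∫ w, (Real.exp (-‖w‖ ^ 2 / 2) : ℂ) * g w ∂areaMeasure := by
  rw [gaussianMeasure, integral_withDensity_eq_integral_toReal_smul (by fun_prop)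
    (Eventually.of_forall fun _ => ENNReal.ofReal_lt_top), ← integral_const_mul]
  refine integral_congr_ae (Eventually.of_forall fun w => ?_)
  simp only
  rw [ENNReal.toReal_ofReal (by positivity), Complex.real_smul]
  push_cast
  ring

/-- Makes the Gaussian integral of a Weyl translate, after a shift of variable, a multiple of the
pairing of `f` with the kernel. -/
theorem weyl_mul_exp (z : ℂ) (f : ℂ → ℂ) (w : ℂ) :
    (Real.exp (-‖w‖ ^ 2 / 2) : ℂ) * weyl z f w = Complex.exp (-(‖z‖ : ℂ) ^ 2 / 4) *
      ((Real.exp (-‖w + z‖ ^ 2 / 2) : ℂ) * (f (w + z) * conj (kernel z (w + z)))) := by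
  have e : (Real.exp (-‖w‖ ^ 2 / 2) : ℂ) * Complex.exp (-(conj z * w) / 2 - (‖z‖ : ℂ) ^ 2 / 4) =
      Complex.exp (-(‖z‖ : ℂ) ^ 2 / 4) *
        ((Real.exp (-‖w + z‖ ^ 2 / 2) : ℂ) * conj (kernel z (w + z))) := by
    rw [kernel, ← Complex.exp_conj]
    push_cast
    rw [← Complex.exp_add, ← Complex.exp_add, ← Complex.exp_add]
    congr 1
    simp only [← Complex.mul_conj', map_add, map_mul, map_div₀, Complex.conj_conj, map_ofNat]
    ring
  rw [weyl]
  linear_combination f (w + z) * e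

/-- The reproducing property of the kernel. -/
theorem integral_mul_conj_kernel {f : ℂ → ℂ} (hf : Differentiable ℂ f)
    (hL : MemLp f 2 gaussianMeasure) (z : ℂ) :
    ∫ w, f w * conj (kernel z w) ∂gaussianMeasure = f z := by
  -- Mean value property at 0 of the Weyl translate, integrable because `λ` is a probability
  -- measure. The factor `exp(-|z|²/4)` appears on both sides and cancels.
  have h := integral_gaussianMeasure_eq (differentiable_weyl z hf)
    ((memLp_weyl z hf hL).integrable (by norm_num))
  have h0 : weyl z f 0 = Complex.exp (-(‖z‖ : ℂ) ^ 2 / 4) * f z := by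
    simp only [weyl, zero_add, mul_zero, neg_zero, zero_div, zero_sub]
    rw [mul_comm, neg_div]
  have hvol : ∀ g : ℂ → ℂ, ∫ w, g (w + z) ∂areaMeasure = ∫ w, g w ∂areaMeasure := fun g => by
    rw [areaMeasure, integral_smul_measure, integral_smul_measure, integral_add_right_eq_self]
  rw [h0, integral_gaussianMeasure] at h
  simp only [weyl_mul_exp] at h
  rw [integral_const_mul,
    hvol fun w => (Real.exp (-‖w‖ ^ 2 / 2) : ℂ) * (f w * conj (kernel z w)),
    mul_left_comm, ← integral_gaussianMeasure] at h
  exact mul_left_cancel₀ (Complex.exp_ne_zero _) h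

/-- An entire function in `L²(ℂ, dλ)` as an element of the Fock space. -/
def ofEntire (f : ℂ → ℂ) (hf : Differentiable ℂ f) (hL : MemLp f 2 gaussianMeasure) : fockSpace :=
  ⟨hL.toLp f, f, hf, hL.coeFn_toLp⟩

theorem memLp_entireRep (f : fockSpace) : MemLp (entireRep f) 2 gaussianMeasure :=
  (memLp_congr_ae (coeFn_eq_entireRep f)).mp (Lp.memLp _)

/-! ### Toeplitz operators through inner products. -/

section Toeplitz

theorem coeFn_holderL_toLp {φ : ℂ → ℂ} (hφ : MemLp φ ∞ areaMeasure) (f : fockSpace) :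
    ⇑((ContinuousLinearMap.mul ℂ ℂ).holderL gaussianMeasure ∞ 2 2
      ((memLp_top_gaussian hφ).toLp φ) (f : Lp ℂ 2 gaussianMeasure)) =ᵐ[gaussianMeasure]
      fun w => φ w * entireRep f w := by
  refine (ContinuousLinearMap.coeFn_holder (ContinuousLinearMap.mul ℂ ℂ) _ _).trans ?_
  filter_upwards [(memLp_top_gaussian hφ).coeFn_toLp, coeFn_eq_entireRep f] with w h1 h2
  rw [h1, h2]
  rfl

/-- The projection disappears because `g` already lies in the Fock space. -/
theorem inner_toeplitz {φ : ℂ → ℂ} (hφ : MemLp φ ∞ areaMeasure) (f g : fockSpace) :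
    inner ℂ g (toeplitz φ hφ f) =
      ∫ w, φ w * entireRep f w * conj (entireRep g w) ∂gaussianMeasure := by
  rw [toeplitz]
  simp only [ContinuousLinearMap.comp_apply, Submodule.subtypeL_apply]
  rw [Submodule.inner_orthogonalProjectionOnto_eq_of_mem_left, L2.inner_def]
  refine integral_congr_ae ?_
  filter_upwards [coeFn_holderL_toLp hφ f, coeFn_eq_entireRep g] with w h1 h2
  rw [h1, h2, RCLike.inner_apply]

/-- Continuous functions equal almost everywhere agree, as the Gaussian measure charges open sets.
-/
theorem entireRep_ofEntire {f : ℂ → ℂ} (hf : Differentiable ℂ f) (hL : MemLp f 2 gaussianMeasure) :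
    entireRep (ofEntire f hf hL) = f :=
  Continuous.ae_eq_iff_eq gaussianMeasure (differentiable_entireRep _).continuous hf.continuous
    |>.mp ((coeFn_eq_entireRep _).symm.trans hL.coeFn_toLp)

theorem inner_eq_integral_entireRep (f g : fockSpace) :
    inner ℂ g f = ∫ w, entireRep f w * conj (entireRep g w) ∂gaussianMeasure := by
  rw [Submodule.coe_inner, L2.inner_def]
  refine integral_congr_ae ?_
  filter_upwards [coeFn_eq_entireRep f, coeFn_eq_entireRep g] with w h1 h2
  rw [h1, h2, RCLike.inner_apply]

/-- Pair with the kernel and use the reproducing property. -/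
theorem entireRep_toeplitz_apply {φ : ℂ → ℂ} (hφ : MemLp φ ∞ areaMeasure) (f : fockSpace) (z : ℂ) :
    entireRep (toeplitz φ hφ f) z =
      ∫ w, φ w * entireRep f w * conj (kernel z w) ∂gaussianMeasure := by
  have h1 := inner_toeplitz hφ f (ofEntire (kernel z) (differentiable_kernel z) (memLp_kernel z))
  rw [inner_eq_integral_entireRep] at h1
  simp only [entireRep_ofEntire] at h1
  rw [← h1, integral_mul_conj_kernel (differentiable_entireRep _) (memLp_entireRep _)]

theorem enorm_sq_eq_lintegral (f : Lp ℂ 2 gaussianMeasure) :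
    ‖f‖ₑ ^ 2 = ∫⁻ w, ‖f w‖ₑ ^ 2 ∂gaussianMeasure := by
  rw [Lp.enorm_def, eLpNorm_eq_lintegral_rpow_enorm_toReal (by norm_num) (by norm_num),
    ← ENNReal.rpow_natCast, ← ENNReal.rpow_mul]
  norm_num

theorem enorm_sq_eq_weightedSq (f : fockSpace) :
    ‖f‖ₑ ^ 2 = 2⁻¹ * ∫⁻ w, weightedSq (entireRep f) w ∂areaMeasure := by
  change ‖(f : Lp ℂ 2 gaussianMeasure)‖ₑ ^ 2 = _
  rw [enorm_sq_eq_lintegral]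
  refine Eq.trans ?_ (lintegral_gaussianMeasure fun w => ‖entireRep f w‖ₑ ^ 2)
  refine lintegral_congr_ae ?_
  filter_upwards [coeFn_eq_entireRep f] with w h
  rw [h]

theorem enorm_toeplitz_sq_le {φ : ℂ → ℂ} (hφ : MemLp φ ∞ areaMeasure) (f : fockSpace) :
    ‖toeplitz φ hφ f‖ₑ ^ 2 ≤
      2⁻¹ * ∫⁻ w, ‖φ w‖ₑ ^ 2 * weightedSq (entireRep f) w ∂areaMeasure := by
  set u := (ContinuousLinearMap.mul ℂ ℂ).holderL gaussianMeasure ∞ 2 2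
      ((memLp_top_gaussian hφ).toLp φ) (f : Lp ℂ 2 gaussianMeasure) with hu
  have h1 : ‖toeplitz φ hφ f‖ₑ ≤ ‖u‖ₑ := by
    rw [enorm_le_iff_norm_le]
    exact fockSpace.norm_orthogonalProjectionOnto_apply_le u
  refine (pow_le_pow_left' h1 2).trans (le_of_eq ?_)
  rw [enorm_sq_eq_lintegral]
  have h2 : ∫⁻ w, ‖u w‖ₑ ^ 2 ∂gaussianMeasure =
      ∫⁻ w, ‖φ w‖ₑ ^ 2 * ‖entireRep f w‖ₑ ^ 2 ∂gaussianMeasure := by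
    refine lintegral_congr_ae ?_
    filter_upwards [coeFn_holderL_toLp hφ f] with w h
    rw [hu, h, enorm_mul, mul_pow]
  rw [h2, lintegral_gaussianMeasure]
  simp only [weightedSq, mul_assoc]

end Toeplitz

/-! ### Symbol versus measure: `T_φ = T_μ` and the Berezin transforms. -/

section Symbol

variable {φ : ℂ → ℝ}

theorem aemeasurable_ofReal_symbol (hφ : MemLp φ ∞ areaMeasure) :
    AEMeasurable (fun z => ENNReal.ofReal (φ z)) areaMeasure :=
  hφ.1.aemeasurable.ennreal_ofReal

theorem lintegral_symbolMeasure (hφ : MemLp φ ∞ areaMeasure) {u : ℂ → ℝ≥0∞} (hu : Measurable u) :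
    ∫⁻ w, u w ∂(areaMeasure.withDensity fun z => ENNReal.ofReal (φ z)) =
      ∫⁻ w, ENNReal.ofReal (φ w) * u w ∂areaMeasure :=
  lintegral_withDensity_eq_lintegral_mul₀ (aemeasurable_ofReal_symbol hφ) hu.aemeasurable

theorem exists_enorm_symbol_le (hφ : MemLp φ ∞ areaMeasure) :
    ∃ M : ℝ≥0∞, M ≠ 0 ∧ M ≠ ∞ ∧ ∀ᵐ z ∂areaMeasure, ‖φ z‖ₑ ≤ M := by
  -- The added 1 keeps `M` nonzero, so that it can be divided by even when `φ` vanishes.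
  refine ⟨eLpNormEssSup φ areaMeasure + 1, by simp, ?_, ?_⟩
  · have := hφ.2
    rw [eLpNorm_exponent_top] at this
    finiteness
  · filter_upwards [ae_le_eLpNormEssSup (f := φ) (μ := areaMeasure)] with z hz
    exact hz.trans le_self_add

theorem integrable_symbol_mul (hφ : MemLp φ ∞ areaMeasure) {E : Type*} [NormedAddCommGroup E]
    [NormedSpace ℝ E] {g : ℂ → E} (hg : Integrable g gaussianMeasure) :
    Integrable (fun w => φ w • g w) gaussianMeasure := by
  obtain ⟨M, hM0, hMt, hM⟩ := exists_enorm_symbol_le hφ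
  refine hg.bdd_smul M.toReal (hφ.1.mono_ac gaussianMeasure_absolutelyContinuous) ?_
  filter_upwards [gaussianMeasure_absolutelyContinuous.ae_le hM] with w hw
  have := ENNReal.toReal_mono hMt hw
  simpa using this

theorem integrable_mul_conj_kernel (f : fockSpace) (z : ℂ) :
    Integrable (fun w => entireRep f w * conj (kernel z w)) gaussianMeasure :=
  (memLp_entireRep f).integrable_mul (memLp_kernel z).star

theorem integrable_toeplitzIntegrand (hφ : MemLp φ ∞ areaMeasure)
    (hφ0 : ∀ᵐ z ∂areaMeasure, 0 ≤ φ z) (f : fockSpace) (z : ℂ) :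
    Integrable (toeplitzIntegrand (entireRep f) z)
      (areaMeasure.withDensity fun z => ENNReal.ofReal (φ z)) := by
  rw [integrable_withDensity_iff_integrable_smul₀' (aemeasurable_ofReal_symbol hφ)
    (Eventually.of_forall fun _ => ENNReal.ofReal_lt_top)]
  have h := integrable_symbol_mul hφ (integrable_mul_conj_kernel f z)
  rw [gaussianMeasure, integrable_withDensity_iff_integrable_smul' (by fun_prop)
    (Eventually.of_forall fun _ => ENNReal.ofReal_lt_top)] at h
  refine (h.const_mul 2).congr ?_
  filter_upwards [hφ0] with w hw
  rw [ENNReal.toReal_ofReal hw, ENNReal.toReal_ofReal (by positivity), toeplitzIntegrand]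
  simp only [Complex.real_smul]
  push_cast
  ring

theorem entireRep_toeplitz_eq_toeplitzMeasure (hφ : MemLp φ ∞ areaMeasure)
    (hφ0 : ∀ᵐ z ∂areaMeasure, 0 ≤ φ z) (f : fockSpace) (z : ℂ) :
    entireRep (toeplitz (fun z => (φ z : ℂ)) hφ.ofReal f) z =
      toeplitzMeasure (areaMeasure.withDensity fun z => ENNReal.ofReal (φ z)) (entireRep f) z := by
  rw [entireRep_toeplitz_apply, toeplitzMeasure, integral_gaussianMeasure,
    integral_withDensity_eq_integral_toReal_smul₀ (aemeasurable_ofReal_symbol hφ)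
    (Eventually.of_forall fun _ => ENNReal.ofReal_lt_top)]
  congr 1
  refine integral_congr_ae ?_
  filter_upwards [hφ0] with w hw
  rw [ENNReal.toReal_ofReal hw, toeplitzIntegrand, Complex.real_smul]
  ring

/-- Bridge between the real quadratic form and integrals in `ℝ≥0∞`; it serves `⟨T_φ f, f⟩` and, with
`f` a normalized kernel, the Berezin transform. -/
theorem ofReal_integral_symbol_mul (hφ : MemLp φ ∞ areaMeasure)
    (hφ0 : ∀ᵐ z ∂areaMeasure, 0 ≤ φ z) {f : ℂ → ℂ} (hf : Continuous f)
    (hL : MemLp f 2 gaussianMeasure) :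
    ENNReal.ofReal (∫ w, φ w * ‖f w‖ ^ 2 ∂gaussianMeasure) = 2⁻¹ *
      ∫⁻ w, weightedSq f w ∂(areaMeasure.withDensity fun z => ENNReal.ofReal (φ z)) := by
  have hi : Integrable (fun w => φ w * ‖f w‖ ^ 2) gaussianMeasure :=
    integrable_symbol_mul hφ hL.integrable_norm_pow'
  have h0 := gaussianMeasure_absolutelyContinuous.ae_le hφ0
  rw [ofReal_integral_eq_lintegral_ofReal hi (by
    filter_upwards [h0] with w hw using mul_nonneg hw (by positivity)),
    lintegral_gaussianMeasure, lintegral_symbolMeasure hφ (measurable_weightedSq hf.measurable)]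
  congr 1
  refine lintegral_congr_ae ?_
  filter_upwards [hφ0] with w hw
  rw [ENNReal.ofReal_mul hw, weightedSq, ← ofReal_norm, ENNReal.ofReal_pow (norm_nonneg _),
    mul_assoc]

theorem berezinMeasure_eq_ofReal_berezin (hφ : MemLp φ ∞ areaMeasure)
    (hφ0 : ∀ᵐ z ∂areaMeasure, 0 ≤ φ z) (z : ℂ) :
    berezinMeasure (areaMeasure.withDensity fun z => ENNReal.ofReal (φ z)) z =
      ENNReal.ofReal (berezin φ z) := by
  rw [berezin, ofReal_integral_symbol_mul hφ hφ0 (differentiable_normalizedKernel z).continuous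
    (memLp_normalizedKernel z), berezinMeasure, one_div]
  rfl

theorem berezinMeasure_eq_weightedSq (μ : Measure ℂ) (z : ℂ) :
    berezinMeasure μ z = 2⁻¹ * ∫⁻ w, weightedSq (normalizedKernel z) w ∂μ := by
  rw [berezinMeasure, one_div]
  rfl

theorem inner_toeplitz_self (hφ : MemLp φ ∞ areaMeasure) (f : fockSpace) :
    inner ℂ f (toeplitz (fun z => (φ z : ℂ)) hφ.ofReal f) =
      ((∫ w, φ w * ‖entireRep f w‖ ^ 2 ∂gaussianMeasure : ℝ) : ℂ) := by
  rw [inner_toeplitz, ← integral_complex_ofReal]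
  refine integral_congr_ae (Eventually.of_forall fun w => ?_)
  simp only
  rw [mul_assoc, Complex.mul_conj']
  push_cast
  rfl

end Symbol

/-! ### Areas of discs and the uniform Gaussian tail. -/

theorem areaMeasure_ball_ne_top (z : ℂ) (r : ℝ) : areaMeasure (ball z r) ≠ ∞ := by
  rw [areaMeasure, Measure.smul_apply, smul_eq_mul]
  exact ENNReal.mul_ne_top ENNReal.ofReal_ne_top measure_ball_lt_top.ne

theorem areaMeasure_ball_eq (z : ℂ) (r : ℝ) : areaMeasure (ball z r) = areaMeasure (ball 0 r) := by
  simp only [areaMeasure, Measure.smul_apply, Measure.addHaar_ball_center volume z r]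

theorem areaMeasure_le_volume : areaMeasure ≤ volume := by
  intro s
  rw [areaMeasure, Measure.smul_apply, smul_eq_mul]
  refine mul_le_of_le_one_left' ?_
  rw [← ENNReal.ofReal_one]
  exact ENNReal.ofReal_le_ofReal (inv_le_one_of_one_le₀ (by linarith [Real.two_le_pi]))

/-- Translation by `z` turns each tail into that of one fixed finite Gaussian measure, so `r` does
not depend on `z`. -/
theorem exists_lintegral_compl_ball_le {ε : ℝ≥0∞} (hε : ε ≠ 0) :
    ∃ r : ℝ, 0 < r ∧ ∀ z, ∫⁻ w in (ball z r)ᶜ, weightedSq (normalizedKernel z) w ∂areaMeasure ≤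
      ε := by
  set ν := areaMeasure.withDensity fun w => ENNReal.ofReal (Real.exp (-‖w‖ ^ 2 / 2)) with hν
  have hνt : ν univ ≠ ∞ := by
    rw [hν, withDensity_apply _ MeasurableSet.univ, Measure.restrict_univ,
      lintegral_exp_areaMeasure]
    simp
  have hlim : Tendsto (fun n : ℕ => ν (ball (0 : ℂ) (n + 1))ᶜ) atTop (𝓝 0) := by
    have h := tendsto_measure_iInter_atTop (μ := ν)
      (s := fun n : ℕ => (ball (0 : ℂ) (n + 1))ᶜ)
      (fun n => measurableSet_ball.compl.nullMeasurableSet)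
      (fun m n hmn => compl_subset_compl.mpr (ball_subset_ball (by gcongr)))
      ⟨0, ne_top_of_le_ne_top hνt (measure_mono (subset_univ _))⟩
    have h0 : (⋂ n : ℕ, (ball (0 : ℂ) ((n : ℝ) + 1))ᶜ) = ∅ := by
      rw [eq_empty_iff_forall_notMem]
      intro x hx
      obtain ⟨n, hn⟩ := exists_nat_gt ‖x‖
      refine mem_iInter.mp hx n ?_
      rw [mem_ball_zero_iff]
      linarith
    rwa [h0, measure_empty] at h
  obtain ⟨n, hn⟩ := (hlim.eventually_lt_const (pos_iff_ne_zero.mpr hε)).exists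
  refine ⟨n + 1, by positivity, fun z => le_trans (le_of_eq ?_) hn.le⟩
  rw [hν, withDensity_apply _ measurableSet_ball.compl]
  simp only [areaMeasure, Measure.restrict_smul, lintegral_smul_measure,
    weightedSq_normalizedKernel]
  rw [← setLIntegral_comp_add_right _ _ z, preimage_compl, preimage_add_right_ball]
  simp

/-! ### The implications between the five conditions. -/

section Invertibility

variable {φ : ℂ → ℝ}

/-- A Toeplitz operator with nonnegative bounded symbol is bounded below only if the symbol gives
a reverse Carleson measure. -/
theorem isReverseCarleson_of_isUnit (hφ : MemLp φ ∞ areaMeasure)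
    (hφ0 : ∀ᵐ z ∂areaMeasure, 0 ≤ φ z)
    (hT : IsUnit (toeplitz (fun z => (φ z : ℂ)) hφ.ofReal)) :
    IsReverseCarleson (areaMeasure.withDensity fun z => ENNReal.ofReal (φ z)) := by
  obtain ⟨M, hM0, hMt, hM⟩ := exists_enorm_symbol_le hφ
  obtain ⟨T, hTT⟩ := hT
  set S : fockSpace →L[ℂ] fockSpace := ↑T⁻¹ with hS
  have hinv : ∀ f, S (toeplitz (fun z => (φ z : ℂ)) hφ.ofReal f) = f := fun f => by
    rw [← hTT, ← mul_apply_eq_comp, hS, Units.inv_mul]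
    rfl
  set B : ℝ≥0∞ := (‖S‖ₑ ^ 2 + 1) * M with hB
  have hB0 : B ≠ 0 := mul_ne_zero (by simp) hM0
  have hBt : B ≠ ∞ := by finiteness
  refine ⟨B⁻¹.toReal, ENNReal.toReal_pos (ENNReal.inv_ne_zero.mpr hBt)
    (ENNReal.inv_ne_top.mpr hB0), fun f hf hL => ?_⟩
  rw [ENNReal.ofReal_toReal (ENNReal.inv_ne_top.mpr hB0)]
  change B⁻¹ * ∫⁻ w, weightedSq f w ∂areaMeasure ≤ ∫⁻ w, weightedSq f w ∂_
  have hm := measurable_weightedSq hf.continuous.measurable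
  set F := ofEntire f hf hL with hF
  have hrep : entireRep F = f := entireRep_ofEntire hf hL
  have h1 : ‖F‖ₑ ^ 2 ≤ ‖S‖ₑ ^ 2 * ‖toeplitz (fun z => (φ z : ℂ)) hφ.ofReal F‖ₑ ^ 2 := by
    rw [← mul_pow]
    refine pow_le_pow_left' ?_ 2
    conv_lhs => rw [← hinv F]
    exact S.le_opENorm _
  have h2 := enorm_toeplitz_sq_le (φ := fun z => (φ z : ℂ)) hφ.ofReal F
  -- This is where boundedness enters: `φ² ≤ Mφ`.
  have h3 : ∫⁻ w, ‖(φ w : ℂ)‖ₑ ^ 2 * weightedSq f w ∂areaMeasure ≤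
      M * ∫⁻ w, weightedSq f w ∂(areaMeasure.withDensity fun z => ENNReal.ofReal (φ z)) := by
    rw [lintegral_symbolMeasure hφ hm, ← lintegral_const_mul' _ _ hMt]
    refine lintegral_mono_ae ?_
    filter_upwards [hM, hφ0] with w hw hw0
    have : ‖(φ w : ℂ)‖ₑ = ENNReal.ofReal (φ w) := by
      rw [← ofReal_norm, Complex.norm_real, Real.norm_of_nonneg hw0]
    rw [Real.enorm_eq_ofReal hw0] at hw
    rw [this, sq, mul_assoc]
    exact mul_le_mul' hw le_rfl
  rw [hrep] at h2
  rw [enorm_sq_eq_weightedSq, hrep] at h1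
  set Q := ∫⁻ w, weightedSq f w ∂(areaMeasure.withDensity fun z => ENNReal.ofReal (φ z)) with hQ
  set I := ∫⁻ w, weightedSq f w ∂areaMeasure with hI
  have h4 : 2⁻¹ * I ≤ 2⁻¹ * (B * Q) := by
    calc 2⁻¹ * I ≤ ‖S‖ₑ ^ 2 * (2⁻¹ * (M * Q)) :=
          h1.trans (mul_le_mul' le_rfl (h2.trans (mul_le_mul' le_rfl h3)))
      _ = 2⁻¹ * (‖S‖ₑ ^ 2 * M * Q) := by ring
      _ ≤ _ := by
        rw [hB]
        gcongr
        exact le_self_add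
  have h5 : I ≤ B * Q := (ENNReal.mul_le_mul_iff_right (by simp) (by simp)).mp h4
  calc B⁻¹ * I ≤ B⁻¹ * (B * Q) := mul_le_mul' le_rfl h5
    _ = Q := by rw [← mul_assoc, ENNReal.inv_mul_cancel hB0 hBt, one_mul]

/-- Lax–Milgram: the reverse Carleson inequality says that the form `⟨T_φ f, f⟩` is coercive, with
the same constant `C`. -/
theorem isUnit_toeplitz_of_isReverseCarleson (hφ : MemLp φ ∞ areaMeasure)
    (hφ0 : ∀ᵐ z ∂areaMeasure, 0 ≤ φ z)
    (h : IsReverseCarleson (areaMeasure.withDensity fun z => ENNReal.ofReal (φ z))) :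
    IsUnit (toeplitz (fun z => (φ z : ℂ)) hφ.ofReal) := by
  obtain ⟨C, hC, hCarl⟩ := h
  refine ContinuousLinearMap.isUnit_of_forall_le_norm_inner_map _ (c := ⟨C, hC.le⟩) hC
    fun f => ?_
  have hd := differentiable_entireRep f
  have hL := memLp_entireRep f
  have h1 : ENNReal.ofReal C * ∫⁻ w, weightedSq (entireRep f) w ∂areaMeasure ≤
      ∫⁻ w, weightedSq (entireRep f) w ∂(areaMeasure.withDensity fun z => ENNReal.ofReal (φ z)) :=
    hCarl (entireRep f) hd hL
  rw [norm_inner_symm, inner_toeplitz_self hφ, Complex.norm_real]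
  have h2 : ENNReal.ofReal (‖f‖ ^ 2 * C) ≤
      ENNReal.ofReal (∫ w, φ w * ‖entireRep f w‖ ^ 2 ∂gaussianMeasure) := by
    rw [ofReal_integral_symbol_mul hφ hφ0 hd.continuous hL, mul_comm, ENNReal.ofReal_mul hC.le,
      ENNReal.ofReal_pow (norm_nonneg _), ofReal_norm, enorm_sq_eq_weightedSq, mul_left_comm]
    exact mul_le_mul' le_rfl h1
  have h0 : 0 ≤ ∫ w, φ w * ‖entireRep f w‖ ^ 2 ∂gaussianMeasure := by
    refine integral_nonneg_of_ae ?_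
    filter_upwards [gaussianMeasure_absolutelyContinuous.ae_le hφ0] with w hw
    exact mul_nonneg hw (by positivity)
  rw [Real.norm_of_nonneg h0]
  exact (ENNReal.ofReal_le_ofReal_iff h0).mp h2

/-- Normalized kernels are unit vectors, so testing on them gives `δ = C`. -/
theorem exists_le_berezin_of_isReverseCarleson (hφ : MemLp φ ∞ areaMeasure)
    (hφ0 : ∀ᵐ z ∂areaMeasure, 0 ≤ φ z)
    (h : IsReverseCarleson (areaMeasure.withDensity fun z => ENNReal.ofReal (φ z))) :
    ∃ δ : ℝ, 0 < δ ∧ ∀ z : ℂ, δ ≤ berezin φ z := by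
  obtain ⟨C, hC, hCarl⟩ := h
  refine ⟨C, hC, fun z => ?_⟩
  have h1 : ENNReal.ofReal C * ∫⁻ w, weightedSq (normalizedKernel z) w ∂areaMeasure ≤
      ∫⁻ w, weightedSq (normalizedKernel z) w
        ∂(areaMeasure.withDensity fun z => ENNReal.ofReal (φ z)) :=
    hCarl _ (differentiable_normalizedKernel z) (memLp_normalizedKernel z)
  rw [lintegral_weightedSq_normalizedKernel] at h1
  have h2 : ENNReal.ofReal C ≤ ENNReal.ofReal (berezin φ z) := by
    rw [← berezinMeasure_eq_ofReal_berezin hφ hφ0, berezinMeasure_eq_weightedSq]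
    calc ENNReal.ofReal C = 2⁻¹ * (ENNReal.ofReal C * 2) := by
          rw [mul_left_comm, ENNReal.inv_mul_cancel (by simp) (by simp), mul_one]
      _ ≤ _ := mul_le_mul' le_rfl h1
  have h0 : 0 < berezin φ z := by
    by_contra! hneg
    rw [ENNReal.ofReal_of_nonpos hneg] at h2
    simp [hC.not_ge] at h2
  exact (ENNReal.ofReal_le_ofReal_iff h0.le).mp h2

theorem symbolMeasure_le {M : ℝ≥0∞}
    (hM : ∀ᵐ z ∂areaMeasure, ‖φ z‖ₑ ≤ M) (s : Set ℂ) (hs : MeasurableSet s) :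
    (areaMeasure.withDensity fun z => ENNReal.ofReal (φ z)).restrict s ≤
      M • areaMeasure.restrict s := by
  rw [restrict_withDensity hs, ← withDensity_const]
  refine withDensity_mono (ae_restrict_of_ae ?_)
  filter_upwards [hM] with z hz
  exact (Real.ofReal_le_enorm _).trans hz

/-- Since `μ ≤ M dA`, the part of the Berezin integral outside a large disc is negligible uniformly
in `z`; inside, the integrand is at most 1. -/
theorem reverseCarlesonCondition_of_le_berezin (hφ : MemLp φ ∞ areaMeasure)
    (hφ0 : ∀ᵐ z ∂areaMeasure, 0 ≤ φ z) (h : ∃ δ : ℝ, 0 < δ ∧ ∀ z : ℂ, δ ≤ berezin φ z) :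
    ReverseCarlesonCondition (areaMeasure.withDensity fun z => ENNReal.ofReal (φ z)) := by
  obtain ⟨δ, hδ, hδb⟩ := h
  obtain ⟨M, hM0, hMt, hM⟩ := exists_enorm_symbol_le hφ
  set μ := areaMeasure.withDensity fun z => ENNReal.ofReal (φ z) with hμ
  have hle : ∀ s, MeasurableSet s → μ.restrict s ≤ M • areaMeasure.restrict s :=
    symbolMeasure_le hM
  -- With tail `δ / M`, the outside contributes at most `δ`, while the factor 1/2 in the transform
  -- makes the full integral at least `2δ`.
  obtain ⟨r, hr, htail⟩ := exists_lintegral_compl_ball_le (ε := ENNReal.ofReal δ / M)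
    (ENNReal.div_ne_zero.mpr ⟨by simpa using hδ, hMt⟩)
  have hupper : ∀ z, μ (ball z r) ≤ M * areaMeasure (ball 0 r) := fun z => by
    have := hle (ball z r) measurableSet_ball univ
    simpa [areaMeasure_ball_eq z r] using this
  have hUt : M * areaMeasure (ball 0 r) ≠ ∞ := ENNReal.mul_ne_top hMt (areaMeasure_ball_ne_top _ _)
  have hlower : ∀ z, ENNReal.ofReal δ ≤ μ (ball z r) := fun z => by
    have h1 : ENNReal.ofReal δ ≤ 2⁻¹ * ∫⁻ w, weightedSq (normalizedKernel z) w ∂μ := by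
      rw [← berezinMeasure_eq_weightedSq, hμ, berezinMeasure_eq_ofReal_berezin hφ hφ0]
      exact ENNReal.ofReal_le_ofReal (hδb z)
    have h2 : ∫⁻ w in ball z r, weightedSq (normalizedKernel z) w ∂μ ≤ μ (ball z r) := by
      rw [← setLIntegral_one]
      refine lintegral_mono fun w => ?_
      rw [weightedSq_normalizedKernel, ← ENNReal.ofReal_one]
      refine ENNReal.ofReal_le_ofReal (Real.exp_le_one_iff.mpr ?_)
      have := sq_nonneg ‖w - z‖
      linarith
    have h3 : ∫⁻ w in (ball z r)ᶜ, weightedSq (normalizedKernel z) w ∂μ ≤ ENNReal.ofReal δ := by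
      refine (lintegral_mono' (hle _ measurableSet_ball.compl) le_rfl).trans ?_
      rw [lintegral_smul_measure, smul_eq_mul]
      refine (mul_le_mul' le_rfl (htail z)).trans ?_
      exact ENNReal.mul_div_le
    rw [← lintegral_add_compl _ (measurableSet_ball (x := z) (ε := r))] at h1
    have h4 : ENNReal.ofReal δ + ENNReal.ofReal δ ≤ μ (ball z r) + ENNReal.ofReal δ := by
      calc ENNReal.ofReal δ + ENNReal.ofReal δ = 2 * ENNReal.ofReal δ := (two_mul _).symm
        _ ≤ 2 * (2⁻¹ * (_ + _)) := mul_le_mul' le_rfl h1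
        _ = _ := by rw [← mul_assoc, ENNReal.mul_inv_cancel (by simp) (by simp), one_mul]
        _ ≤ _ := add_le_add h2 h3
    exact (ENNReal.add_le_add_iff_right ENNReal.ofReal_ne_top).mp h4
  refine ⟨r, hr, max δ⁻¹ (M * areaMeasure (ball 0 r)).toReal, lt_max_of_lt_left (by positivity),
    fun z => ⟨?_, ?_⟩⟩
  · refine le_trans (ENNReal.ofReal_le_ofReal ?_) (hlower z)
    exact inv_le_of_inv_le₀ hδ (le_max_left _ _)
  · refine (hupper z).trans ?_
    rw [← ENNReal.ofReal_toReal hUt]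
    refine ENNReal.ofReal_le_ofReal ?_
    rw [ENNReal.toReal_ofReal (by positivity)]
    exact le_max_right _ _

/-- Off `G` the symbol is at most `s`, too small to produce half of the mass `C⁻¹`; on `G` it is at
most `M`, so `G` must fill area at least `C⁻¹ / (2M)` of each disc. -/
theorem exists_isReverseCarleson_restrict_of_condition (hφ : MemLp φ ∞ areaMeasure)
    (h : ReverseCarlesonCondition (areaMeasure.withDensity fun z => ENNReal.ofReal (φ z))) :
    ∃ r : ℝ, 0 < r ∧ IsReverseCarleson (areaMeasure.restrict {z : ℂ | r < φ z}) := by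
  obtain ⟨R, hR, C, hC, hball⟩ := h
  obtain ⟨M, hM0, hMt, hM⟩ := exists_enorm_symbol_le hφ
  set A := areaMeasure (ball 0 R) with hA
  have hAt : A ≠ ∞ := areaMeasure_ball_ne_top _ _
  -- Ensures `s * A ≤ C⁻¹ / 2`; the added 1 makes the denominator visibly positive.
  set s : ℝ := C⁻¹ / 2 / (A.toReal + 1) with hs
  have hs0 : 0 < s := by positivity
  have hsA : ENNReal.ofReal s * A ≤ ENNReal.ofReal (C⁻¹ / 2) := by
    rw [← ENNReal.ofReal_toReal hAt, ← ENNReal.ofReal_mul hs0.le]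
    refine ENNReal.ofReal_le_ofReal ?_
    calc s * A.toReal ≤ s * (A.toReal + 1) := by gcongr; linarith
      _ = _ := div_mul_cancel₀ _ (by positivity)
  set G := {z : ℂ | s < φ z} with hG
  refine ⟨s, hs0, isReverseCarleson_areaMeasure_restrict (R := R)
    (δ := ENNReal.ofReal (C⁻¹ / 2) / M) hR ?_ fun z => ?_⟩
  · exact ENNReal.div_ne_zero.mpr ⟨by simpa using hC, hMt⟩
  have h1 : ENNReal.ofReal C⁻¹ ≤ M * areaMeasure (G ∩ ball z R) + ENNReal.ofReal (C⁻¹ / 2) := by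
    refine (hball z).1.trans ?_
    rw [withDensity_apply _ measurableSet_ball]
    calc ∫⁻ w in ball z R, ENNReal.ofReal (φ w) ∂areaMeasure
        ≤ ∫⁻ w in ball z R, G.indicator (fun _ => M) w + ENNReal.ofReal s ∂areaMeasure := by
          refine lintegral_mono_ae (ae_restrict_of_ae ?_)
          filter_upwards [hM] with w hw
          by_cases hwG : w ∈ G
          · rw [indicator_of_mem hwG]
            exact ((Real.ofReal_le_enorm _).trans hw).trans le_self_add
          · rw [indicator_of_notMem hwG, zero_add]
            exact ENNReal.ofReal_le_ofReal (not_lt.mp hwG)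
      _ = (∫⁻ w in ball z R, G.indicator (fun _ => M) w ∂areaMeasure) +
            ENNReal.ofReal s * A := by
          rw [lintegral_add_right _ measurable_const, setLIntegral_const, areaMeasure_ball_eq]
      _ ≤ _ := by
          refine add_le_add ?_ hsA
          refine (lintegral_indicator_le _ _).trans (le_of_eq ?_)
          rw [setLIntegral_const, Measure.restrict_apply' measurableSet_ball]
  have h2 : ENNReal.ofReal (C⁻¹ / 2) ≤ M * areaMeasure (G ∩ ball z R) := by
    have h3 : ENNReal.ofReal C⁻¹ = ENNReal.ofReal (C⁻¹ / 2) + ENNReal.ofReal (C⁻¹ / 2) := by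
      rw [← ENNReal.ofReal_add (by positivity) (by positivity), add_halves]
    rw [h3] at h1
    exact (ENNReal.add_le_add_iff_right ENNReal.ofReal_ne_top).mp h1
  -- The domination theorem measures with `volume`, which exceeds `areaMeasure` because `π ≥ 1`.
  exact (ENNReal.div_le_of_le_mul' h2).trans (areaMeasure_le_volume _)

/-- `φ` dominates `r` times the indicator of the set. -/
theorem isReverseCarleson_of_restrict (hφ : MemLp φ ∞ areaMeasure)
    (h : ∃ r : ℝ, 0 < r ∧ IsReverseCarleson (areaMeasure.restrict {z : ℂ | r < φ z})) :
    IsReverseCarleson (areaMeasure.withDensity fun z => ENNReal.ofReal (φ z)) := by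
  obtain ⟨r, hr, C, hC, hCarl⟩ := h
  refine ⟨r * C, by positivity, fun f hf hL => ?_⟩
  have hm := measurable_weightedSq hf.continuous.measurable
  change _ ≤ ∫⁻ w, weightedSq f w ∂_
  rw [lintegral_symbolMeasure hφ hm, ENNReal.ofReal_mul hr.le, mul_assoc]
  refine (mul_le_mul' le_rfl (hCarl f hf hL)).trans ?_
  change _ * ∫⁻ w in {z : ℂ | r < φ z}, weightedSq f w ∂areaMeasure ≤ _
  rw [← lintegral_const_mul _ hm]
  refine le_trans (lintegral_mono_ae ?_) (setLIntegral_le_lintegral _ _)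
  have hG : NullMeasurableSet {z : ℂ | r < φ z} areaMeasure :=
    nullMeasurableSet_lt aemeasurable_const hφ.1.aemeasurable
  filter_upwards [ae_restrict_mem₀ hG] with w hw
  exact mul_le_mul' (ENNReal.ofReal_le_ofReal (le_of_lt hw)) le_rfl

end Invertibility

end Fock
end

theorem mainTheorem7 (φ : ℂ → ℝ) (hφ : MemLp φ ∞ Fock.areaMeasure)
    (hφ_nonneg : ∀ᵐ z ∂Fock.areaMeasure, 0 ≤ φ z)
    (μ : Measure ℂ) (hμ : μ = Fock.areaMeasure.withDensity fun z => ENNReal.ofReal (φ z)) :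
    -- the operator and the transform of `μ` are those of `φ`
    (∀ (f : Fock.fockSpace) (z : ℂ),
      Integrable (Fock.toeplitzIntegrand (Fock.entireRep f) z) μ ∧
      Fock.entireRep (Fock.toeplitz (fun z => (φ z : ℂ)) hφ.ofReal f) z =
        Fock.toeplitzMeasure μ (Fock.entireRep f) z) ∧
    (∀ z : ℂ, Fock.berezinMeasure μ z = ENNReal.ofReal (Fock.berezin φ z)) ∧
    List.TFAE [
      IsUnit (Fock.toeplitz (fun z => (φ z : ℂ)) hφ.ofReal),
      ∃ δ : ℝ, 0 < δ ∧ ∀ z : ℂ, δ ≤ Fock.berezin φ z,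
      ∃ r : ℝ, 0 < r ∧ Fock.IsReverseCarleson (Fock.areaMeasure.restrict {z : ℂ | r < φ z}),
      Fock.IsReverseCarleson μ,
      Fock.ReverseCarlesonCondition μ] := by
  subst hμ
  refine ⟨fun f z => ⟨Fock.integrable_toeplitzIntegrand hφ hφ_nonneg f z,
    Fock.entireRep_toeplitz_eq_toeplitzMeasure hφ hφ_nonneg f z⟩,
    Fock.berezinMeasure_eq_ofReal_berezin hφ hφ_nonneg, ?_⟩
  -- Statement (d) is the hub: it is equivalent to (a), and the rest is the cycle (d) ⇒ (b) ⇒ (e) ⇒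
  -- (c) ⇒ (d).
  tfae_have 1 → 4 := Fock.isReverseCarleson_of_isUnit hφ hφ_nonneg
  tfae_have 4 → 1 := Fock.isUnit_toeplitz_of_isReverseCarleson hφ hφ_nonneg
  tfae_have 4 → 2 := Fock.exists_le_berezin_of_isReverseCarleson hφ hφ_nonneg
  tfae_have 2 → 5 := Fock.reverseCarlesonCondition_of_le_berezin hφ hφ_nonneg
  tfae_have 5 → 3 := Fock.exists_isReverseCarleson_restrict_of_condition hφ
  tfae_have 3 → 4 := Fock.isReverseCarleson_of_restrict hφ
  tfae_finish
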